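/- Let an instance of the Membership Problem for hypergeometric sequences consist of polynomials $f,g\in\mathbb{Z}[x]$, where $f$ has no non-negative integer zero, an initial value $u_0\in\mathbb{Q}$ and a target $t\in\mathbb{Q}$. It determines a unique sequence $\langle u_n\rangle_{n=0}^\infty$ of rational numbers with the given initial value $u_0$ satisfying $$f(n)\,u_n-g(n)\,u_{n-1}=0\qquad(n\ge 1),$$ and the problem asks whether there is an integer $n\ge 0$ with $u_n=t$. **Theorem.** The Membership Problem is decidable for instances in which $f$ and $g$ are both monic and both split completely over one quadratic (degree-two) extension $\mathbb{K}$ of $\mathbb{Q}$. That is, there is a single algorithm (a computable function) which, given the integer coefficients of $f$ and $g$ and the numerators and denominators of $u_0$ and $t$, correctly decides for every such instance whether $u_n=t$ for some $n\ge 0$. The field $\mathbb{K}$ may vary with the instance and is not part of the input. -/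

import Mathlib

open Polynomial

/-- An instance of the Membership Problem for hypergeometric sequences: the recurrence
`f(n) u_n - g(n) u_{n-1} = 0` with `f, g ∈ ℤ[x]`, where `f` has no non-negative integer zero,
an initial value `u_0 ∈ ℚ` and a target `t ∈ ℚ`. -/
structure MembershipInstance where
  f : ℤ[X]
  g : ℤ[X]
  eval_f_ne_zero : ∀ n : ℕ, f.eval (n : ℤ) ≠ 0
  init : ℚ
  target : ℚ

namespace MembershipInstance

/-- The hypergeometric sequence `⟨u_n⟩` given by the recurrence and the initial value. -/
def seq (I : MembershipInstance) : ℕ → ℚ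
  | 0 => I.init
  | n + 1 => ((I.g.eval ((n : ℤ) + 1) : ℤ) : ℚ) / ((I.f.eval ((n : ℤ) + 1) : ℤ) : ℚ) * I.seq n

/-- `I.seq` is the unique sequence with initial value `u_0` satisfying
`f(n) u_n - g(n) u_{n-1} = 0` for all `n ≥ 1`. -/
theorem eq_seq_iff (I : MembershipInstance) (u : ℕ → ℚ) :
    u = I.seq ↔ u 0 = I.init ∧ ∀ n : ℕ, 1 ≤ n →
      ((I.f.eval (n : ℤ) : ℤ) : ℚ) * u n - ((I.g.eval (n : ℤ) : ℤ) : ℚ) * u (n - 1) = 0 := by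
  have hf : ∀ n : ℕ, ((I.f.eval ((n : ℤ) + 1) : ℤ) : ℚ) ≠ 0 := fun n => by
    have := I.eval_f_ne_zero (n + 1)
    push_cast at this
    exact_mod_cast this
  constructor
  · rintro rfl
    refine ⟨rfl, fun n hn => ?_⟩
    obtain ⟨m, rfl⟩ : ∃ m, n = m + 1 := ⟨n - 1, by omega⟩
    have := hf m
    simp only [seq, Nat.add_sub_cancel, Nat.cast_add, Nat.cast_one]
    field_simp
    simp
  · rintro ⟨h0, h⟩
    funext n
    induction n with
    | zero => exact h0
    | succ m ih =>
      have hm := h (m + 1) (by omega)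
      have := hf m
      simp only [Nat.add_sub_cancel, Nat.cast_add, Nat.cast_one] at hm
      rw [seq, ← ih, div_mul_eq_mul_div, eq_div_iff this]
      linarith

/-- The question asked by the instance: does the target occur in the sequence? -/
def IsMember (I : MembershipInstance) : Prop :=
  ∃ n : ℕ, I.seq n = I.target

/-- The finite data by which an instance is presented to an algorithm: the coefficient lists of
`f` and `g` (leading coefficient first), and `u_0` and `t` as reduced fractions
(numerator, denominator). -/
def code (I : MembershipInstance) : List ℤ × List ℤ × (ℤ × ℕ) × (ℤ × ℕ) :=
  (I.f.coeffList, I.g.coeffList, (I.init.num, I.init.den), (I.target.num, I.target.den))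

end MembershipInstance

/-- The Membership Problem is decidable for the instances in the class `C`: one algorithm answers
correctly every instance in `C`, given its finite presentation. -/
def MembershipDecidableOn (C : Set MembershipInstance) : Prop :=
  ∃ A : List ℤ × List ℤ × (ℤ × ℕ) × (ℤ × ℕ) → Bool,
    Computable A ∧ ∀ I ∈ C, (A I.code = true ↔ I.IsMember)

/-- `f` and `g` both split completely over one quadratic extension of `ℚ`
(number fields being taken as subfields of `ℂ`). -/
def SplitOverQuadraticField (f g : ℤ[X]) : Prop :=
  ∃ K : IntermediateField ℚ ℂ, Module.finrank ℚ K = 2 ∧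
    (f.map (algebraMap ℤ K)).Splits ∧ (g.map (algebraMap ℤ K)).Splits

/-!
The decision procedure searches for an index `n` with `uₙ = t` up to an explicit, primitive
recursive bound in the size of the input (`searchBound`). The mathematical content is that a member
of the sequence has an index below that bound, `exists_index_le_searchBound`.

After clearing denominators, `uₙ = t` reads `c ∏ g(k) = c' ∏ f(k)`, the products being over
`1 ≤ k ≤ n`, where `c = c'` means `u₀ = t`. Apart from the trivial cases `u₀ = 0` and `t = 0` there
are two possibilities. If the degrees differ, then the products grow at different rates and `n` is
bounded (`le_growthBound`). If they agree, write `f` and `g` as products of linear and quadratic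
factors over `ℤ`; the discriminants of the quadratic factors have the form `m² D` with a common
nonsquare `D`, and `m` is called the class of the factor (`0` for linear factors).

* Factors of equal class are integer translates of each other. Hence if `f` and `g` have the same
  classes, the quotient of the products telescopes to a quotient of integers, each congruent to one
  and the same `R ≠ 0` modulo `n`. So `n` divides `(c - c') R`, where `R` is bounded, and either
  `n` is bounded or `u₀ = t` already (`ShiftFactor.const_eq_of_prod_eq`).
* If `n` is large, then `f` and `g` do have the same classes (`ShiftFactor.map_m_eq`). Suppose a
  prime `p`, large compared with `n`, divides `r² - D`. A quadratic factor `x² + b x + c` of class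
  `m` has the zeros `(-b ± m r) / 2` modulo `p`, so that `p` divides its values at `1, …, n` exactly
  once if `m r - b ≤ 2 n` and never otherwise. Choosing `r` suitably between `2 n / (m₁ + 1)` and
  `2 n / m₁`, and comparing the exponents of `p` on both sides, shows that `f` and `g` have equally
  many quadratic factors of class at most `m₁`.

What remains is to find `r` in a prescribed interval, of length proportional to `n`, such that
`r² - D` has a prime factor exceeding a large multiple of `n` (`exists_large_prime_factor`). If
there were none, the product of all these `r² - D` would be composed of primes that are `O(n)`. An
argument of Sylvester's type bounds the contribution of each prime `p` by twice its contribution to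
a factorial of the same logarithmic size, while the inert primes, modulo which `D` is not a square,
contribute nothing. So the sum of `log p / p` over the inert primes would be bounded
(`sum_inertPrimes_le_of_smooth`). This is refuted without `L`-functions by looking at the
values `x² - D y²` in a square `0 ≤ x, y ≤ X` (`log_le_sum_inertPrimes_sq`): a split prime `p ≤ X`
divides about `2 X² / p` of them, a split prime `X < p ≤ X²` at least `X² / p - 1` by the pigeonhole
principle, and if almost all primes were split these contributions would add up to `3 X² log X`,
whereas the product of all the values has logarithm about `2 X² log X`. All constants are explicit,
which makes the bound for `n` computable.
-/

/-! ### Primes and logarithms -/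

theorem log_eq_sum_primesLE {N Z : ℕ} (h : ∀ p, p.Prime → p ∣ N → p ≤ Z) :
    Real.log N = ∑ p ∈ Nat.primesLE Z, (N.factorization p : ℝ) * Real.log p := by
  rw [Real.log_nat_eq_sum_factorization]
  refine Finsupp.sum_of_support_subset _ (fun p hp => ?_) _ (by simp)
  rw [Nat.support_factorization, Nat.mem_primeFactors] at hp
  exact Nat.mem_primesLE.2 ⟨h p hp.1 hp.2.1, hp.1⟩

theorem sum_log_primes_le_log {N : ℕ} (hN : N ≠ 0) (s : Finset ℕ)
    (hs : ∀ p ∈ s, p.Prime ∧ p ∣ N) : ∑ p ∈ s, Real.log p ≤ Real.log N := by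
  have h1 : ∏ p ∈ s, p ∣ N :=
    Finset.prod_primes_dvd N (fun p hp => (hs p hp).1.prime) (fun p hp => (hs p hp).2)
  have h2 : Real.log ((∏ p ∈ s, p : ℕ) : ℝ) = ∑ p ∈ s, Real.log p := by
    rw [Nat.cast_prod, Real.log_prod]
    intro p hp
    exact_mod_cast (hs p hp).1.ne_zero
  rw [← h2]
  refine Real.log_le_log ?_ (by exact_mod_cast Nat.le_of_dvd (Nat.pos_of_ne_zero hN) h1)
  exact_mod_cast Finset.prod_pos fun p hp => (hs p hp).1.pos

theorem sum_log_primesLE_le (n : ℕ) : ∑ p ∈ Nat.primesLE n, Real.log p ≤ Real.log 4 * n := by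
  rw [← Chebyshev.theta_eq_sum_primesLE_log]
  exact Chebyshev.theta_le_log4_mul_x (Nat.cast_nonneg n)

theorem log_four_le : Real.log 4 ≤ 1.4 := by
  rw [show (4 : ℝ) = 2 ^ 2 by norm_num, Real.log_pow]
  have := Real.log_two_lt_d9
  push_cast
  linarith

/-- The telescoping majorant is `(log k + 2) / k`. -/
theorem sum_log_div_mul_pred_le {n : ℕ} (hn : 1 ≤ n) :
    ∑ k ∈ Finset.Icc 2 n, Real.log k / (k * (k - 1)) ≤ 2 - (Real.log n + 2) / n := by
  induction n, hn using Nat.le_induction with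
  | base => simp
  | succ n hn ih =>
    rw [Finset.sum_Icc_succ_top (by omega)]
    have hn0 : (0 : ℝ) < n := by exact_mod_cast hn
    have hn1 : (0 : ℝ) < (n : ℝ) + 1 := by positivity
    have h1 : Real.log (n + 1) - Real.log n ≤ 1 / n := by
      rw [← Real.log_div hn1.ne' hn0.ne']
      refine (Real.log_le_sub_one_of_pos (by positivity)).trans (le_of_eq ?_)
      field_simp
      ring
    have h2 : Real.log (n + 1) / ((n + 1) * (n + 1 - 1))
        ≤ (Real.log n + 2) / n - (Real.log (n + 1) + 2) / (n + 1) := by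
      rw [add_sub_cancel_right, div_sub_div _ _ hn0.ne' hn1.ne', mul_comm ((n : ℝ) + 1) (n : ℝ),
        div_le_div_iff_of_pos_right (by positivity)]
      have h3 : ((n : ℝ) + 1) * (Real.log (n + 1) - Real.log n) ≤ (n + 1) * (1 / n) :=
        mul_le_mul_of_nonneg_left h1 hn1.le
      have h4 : ((n : ℝ) + 1) * (1 / n) ≤ 2 := by
        rw [mul_one_div, div_le_iff₀ hn0]
        have : (1 : ℝ) ≤ n := by exact_mod_cast hn
        linarith
      nlinarith
    push_cast
    linarith

theorem sum_primesLE_log_div_mul_pred_le (n : ℕ) :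
    ∑ p ∈ Nat.primesLE n, Real.log p / (p * (p - 1)) ≤ 2 := by
  rcases Nat.eq_zero_or_pos n with rfl | hn
  · simp
  have h1 : ∑ p ∈ Nat.primesLE n, Real.log p / (p * (p - 1))
      ≤ ∑ k ∈ Finset.Icc 2 n, Real.log k / ((k : ℝ) * (k - 1)) := by
    refine Finset.sum_le_sum_of_subset_of_nonneg (fun p hp => ?_) (fun k hk _ => ?_)
    · rw [Nat.mem_primesLE] at hp
      exact Finset.mem_Icc.2 ⟨hp.2.two_le, hp.1⟩
    · have hk1 : (1 : ℝ) ≤ k := by exact_mod_cast (by have := (Finset.mem_Icc.1 hk).1; omega : 1 ≤ k)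
      exact div_nonneg (Real.log_natCast_nonneg k) (mul_nonneg (by linarith) (by linarith))
  have h2 := sum_log_div_mul_pred_le hn
  have h3 : 0 ≤ (Real.log n + 2) / n :=
    div_nonneg (by linarith [Real.log_natCast_nonneg n]) (Nat.cast_nonneg n)
  linarith

theorem sum_primesLE_log_div_sq_le (n : ℕ) :
    ∑ p ∈ Nat.primesLE n, Real.log p / (p : ℝ) ^ 2 ≤ 2 := by
  refine le_trans (Finset.sum_le_sum fun p hp => ?_) (sum_primesLE_log_div_mul_pred_le n)
  have hp2 : (2 : ℝ) ≤ p := by exact_mod_cast (Nat.mem_primesLE.1 hp).2.two_le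
  refine div_le_div_of_nonneg_left (Real.log_natCast_nonneg p)
    (mul_pos (by linarith) (by linarith)) (by nlinarith)

/-- The lower bound in Mertens' first theorem, read off from the factorization of `n!`. -/
theorem log_sub_three_le_sum_primesLE {n : ℕ} (hn : 1 ≤ n) :
    Real.log n - 3 ≤ ∑ p ∈ Nat.primesLE n, Real.log p / p := by
  have hn0 : (0 : ℝ) < n := by exact_mod_cast hn
  have h1 : (n : ℝ) * Real.log n - n ≤ Real.log (n.factorial : ℕ) := by
    have h := Stirling.le_log_factorial_stirling (n := n) (by omega)
    have h2 : 0 ≤ Real.log (2 * Real.pi) := Real.log_nonneg (by linarith [Real.pi_gt_three])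
    have h3 := Real.log_natCast_nonneg n
    linarith
  have h2 : Real.log (n.factorial : ℕ) ≤
      ∑ p ∈ Nat.primesLE n, (n : ℝ) * (Real.log p / p + Real.log p / (p * (p - 1))) := by
    rw [log_eq_sum_primesLE (N := n.factorial) (Z := n) fun p hp h => (hp.dvd_factorial).1 h]
    refine Finset.sum_le_sum fun p hp => ?_
    have hpp := (Nat.mem_primesLE.1 hp).2
    have hp2 : (2 : ℝ) ≤ p := by exact_mod_cast hpp.two_le
    have h4 : (n.factorial.factorization p : ℝ) ≤ n / (p - 1) := by
      refine le_trans (Nat.cast_le.2 (Nat.factorization_factorial_le_div_pred hpp n)) ?_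
      refine Nat.cast_div_le.trans ?_
      rw [Nat.cast_sub hpp.one_le]
      simp
    refine (mul_le_mul_of_nonneg_right h4 (Real.log_natCast_nonneg p)).trans (le_of_eq ?_)
    have : (p : ℝ) - 1 ≠ 0 := by linarith
    field_simp
    ring
  rw [← Finset.mul_sum, Finset.sum_add_distrib] at h2
  have h3 := sum_primesLE_log_div_mul_pred_le n
  have h5 : (n : ℝ) * (Real.log n - 3) ≤ n * ∑ p ∈ Nat.primesLE n, Real.log p / p := by
    nlinarith
  exact le_of_mul_le_mul_left h5 hn0

theorem div_sub_one_le_factorization_factorial {p : ℕ} (hp : p.Prime) (n : ℕ) :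
    (n : ℝ) / p - 1 ≤ n.factorial.factorization p := by
  have h1 : n / p ≤ n.factorial.factorization p := by
    rw [Nat.factorization_factorial hp (b := Nat.log p n + 2) (by omega)]
    have : n / p ^ 1 ≤ ∑ i ∈ Finset.Ico 1 (Nat.log p n + 2), n / p ^ i :=
      Finset.single_le_sum (f := fun i => n / p ^ i) (fun _ _ => Nat.zero_le _)
        (Finset.mem_Ico.2 ⟨le_rfl, by omega⟩)
    simpa using this
  have hp0 : (0 : ℝ) < p := by exact_mod_cast hp.pos
  have h2 : (n : ℝ) < p * ((n / p : ℕ) + 1) := by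
    exact_mod_cast Nat.lt_mul_div_succ n hp.pos
  have h3 : (n : ℝ) / p < (n / p : ℕ) + 1 := by
    rw [div_lt_iff₀ hp0]
    linarith
  have h4 : ((n / p : ℕ) : ℝ) ≤ n.factorial.factorization p := by exact_mod_cast h1
  linarith

/-- An explicit Chebyshev bound, in the shape needed to sum a logarithmic error over the
primes up to `n`. -/
theorem primesLE_card_mul_log_le {n : ℕ} (hn : 2 ≤ n) :
    ((Nat.primesLE n).card : ℝ) * Real.log n ≤ 5 * n := by
  have hn1 : (1 : ℝ) < n := by exact_mod_cast hn
  have hn0 : (0 : ℝ) < n := by linarith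
  have h1 := Chebyshev.pi_le_log4_mul_div hn1
  rw [Nat.floor_natCast, ← Nat.primesLE_card_eq_primeCounting] at h1
  have h2 : Real.log (√(n : ℝ)) = Real.log n / 2 := Real.log_sqrt hn0.le
  have h3 : 0 < Real.log n := Real.log_pos hn1
  have h4 : Real.log (√(n : ℝ)) ≤ √(n : ℝ) - 1 :=
    Real.log_le_sub_one_of_pos (Real.sqrt_pos.2 hn0)
  have h5 : √(n : ℝ) * √(n : ℝ) = n := Real.mul_self_sqrt hn0.le
  have h6 := Real.sqrt_nonneg (n : ℝ)
  have h7 : (Real.log 4 * n / Real.log (√(n : ℝ)) + √(n : ℝ)) * Real.log n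
      = 2 * Real.log 4 * n + √(n : ℝ) * Real.log n := by
    rw [h2]
    field_simp
  have h8 : √(n : ℝ) * Real.log n ≤ 2 * n := by nlinarith
  have h9 := mul_le_mul_of_nonneg_right h1 h3.le
  rw [h7] at h9
  have := log_four_le
  nlinarith

/-! ### Primes that split and primes that stay inert -/

open Classical in
/-- The primes `p ≤ n` modulo which `D` is not a square. -/
noncomputable def inertPrimes (D : ℤ) (n : ℕ) : Finset ℕ :=
  (Nat.primesLE n).filter fun p => ∀ r : ℤ, ¬ (p : ℤ) ∣ r ^ 2 - D

open Classical in
/-- The primes `p ≤ n` modulo which `D` is a square, apart from the divisors of `2 * D`. -/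
noncomputable def splitPrimes (D : ℤ) (n : ℕ) : Finset ℕ :=
  (Nat.primesLE n).filter fun p => (∃ r : ℤ, (p : ℤ) ∣ r ^ 2 - D) ∧ ¬ (p : ℤ) ∣ 2 * D

theorem mem_inertPrimes {D : ℤ} {n p : ℕ} :
    p ∈ inertPrimes D n ↔ (p ≤ n ∧ p.Prime) ∧ ∀ r : ℤ, ¬ (p : ℤ) ∣ r ^ 2 - D := by
  classical rw [inertPrimes, Finset.mem_filter, Nat.mem_primesLE]

theorem mem_splitPrimes {D : ℤ} {n p : ℕ} :
    p ∈ splitPrimes D n ↔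
      (p ≤ n ∧ p.Prime) ∧ (∃ r : ℤ, (p : ℤ) ∣ r ^ 2 - D) ∧ ¬ (p : ℤ) ∣ 2 * D := by
  classical rw [splitPrimes, Finset.mem_filter, Nat.mem_primesLE]

theorem inertPrimes_mono (D : ℤ) {m n : ℕ} (h : m ≤ n) : inertPrimes D m ⊆ inertPrimes D n :=
  fun p hp => by
    rw [mem_inertPrimes] at hp ⊢
    exact ⟨⟨hp.1.1.trans h, hp.1.2⟩, hp.2⟩

theorem splitPrimes_mono (D : ℤ) {m n : ℕ} (h : m ≤ n) : splitPrimes D m ⊆ splitPrimes D n :=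
  fun p hp => by
    rw [mem_splitPrimes] at hp ⊢
    exact ⟨⟨hp.1.1.trans h, hp.1.2⟩, hp.2⟩

theorem splitPrimes_subset_primesLE (D : ℤ) (n : ℕ) : splitPrimes D n ⊆ Nat.primesLE n :=
  by classical exact Finset.filter_subset _ _

theorem inertPrimes_subset_primesLE (D : ℤ) (n : ℕ) : inertPrimes D n ⊆ Nat.primesLE n :=
  by classical exact Finset.filter_subset _ _

theorem log_div_nonneg (p : ℕ) : 0 ≤ Real.log p / (p : ℝ) :=
  div_nonneg (Real.log_natCast_nonneg p) (Nat.cast_nonneg p)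

theorem sum_log_div_union_le (s t : Finset ℕ) :
    ∑ p ∈ s ∪ t, Real.log p / p ≤ ∑ p ∈ s, Real.log p / p + ∑ p ∈ t, Real.log p / p := by
  rw [← Finset.sum_union_inter]
  exact le_add_of_nonneg_right (Finset.sum_nonneg fun p _ => log_div_nonneg p)

theorem sum_inertPrimes_mono (D : ℤ) {m n : ℕ} (h : m ≤ n) :
    ∑ p ∈ inertPrimes D m, Real.log p / p ≤ ∑ p ∈ inertPrimes D n, Real.log p / p :=
  Finset.sum_le_sum_of_subset_of_nonneg (inertPrimes_mono D h) fun p _ _ => log_div_nonneg p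

theorem log_sub_le_sum_splitPrimes {D : ℤ} (hD : D ≠ 0) {n : ℕ} (hn : 1 ≤ n) :
    Real.log n - 3 - 2 * |(D : ℝ)| - ∑ p ∈ inertPrimes D n, Real.log p / p
      ≤ ∑ p ∈ splitPrimes D n, Real.log p / p := by
  have h1 := log_sub_three_le_sum_primesLE hn
  have hsub : Nat.primesLE n ⊆
      (inertPrimes D n ∪ splitPrimes D n) ∪ (2 * D).natAbs.primeFactors := by
    intro p hp
    have hp' := Nat.mem_primesLE.1 hp
    simp only [Finset.mem_union, mem_inertPrimes, mem_splitPrimes]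
    by_cases h2 : (p : ℤ) ∣ 2 * D
    · right
      rw [Nat.mem_primeFactors]
      exact ⟨hp'.2, Int.natCast_dvd.1 h2, by simpa using hD⟩
    · left
      by_cases h3 : ∃ r : ℤ, (p : ℤ) ∣ r ^ 2 - D
      · exact Or.inr ⟨hp', h3, h2⟩
      · exact Or.inl ⟨hp', by simpa using h3⟩
  have h2 : ∑ p ∈ Nat.primesLE n, Real.log p / p ≤
      (∑ p ∈ inertPrimes D n, Real.log p / p + ∑ p ∈ splitPrimes D n, Real.log p / p)
        + ∑ p ∈ (2 * D).natAbs.primeFactors, Real.log p / p := by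
    refine (Finset.sum_le_sum_of_subset_of_nonneg hsub fun p _ _ => log_div_nonneg p).trans ?_
    refine (sum_log_div_union_le _ _).trans ?_
    gcongr
    exact sum_log_div_union_le _ _
  have h3 : ∑ p ∈ (2 * D).natAbs.primeFactors, Real.log p / p ≤ 2 * |(D : ℝ)| := by
    have h4 : ∑ p ∈ (2 * D).natAbs.primeFactors, Real.log p / p
        ≤ ∑ p ∈ (2 * D).natAbs.primeFactors, (1 : ℝ) := by
      refine Finset.sum_le_sum fun p hp => ?_
      have hp0 : (0 : ℝ) < p := by exact_mod_cast (Nat.prime_of_mem_primeFactors hp).pos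
      rw [div_le_one hp0]
      exact (Real.log_le_sub_one_of_pos hp0).trans (by linarith)
    have h5 : ((2 * D).natAbs.primeFactors.card : ℝ) ≤ (2 * D).natAbs := by
      have : (2 * D).natAbs.primeFactors ⊆ Finset.Icc 1 (2 * D).natAbs := fun p hp =>
        Finset.mem_Icc.2 ⟨(Nat.prime_of_mem_primeFactors hp).one_le, Nat.le_of_mem_primeFactors hp⟩
      have := Finset.card_le_card this
      rw [Nat.card_Icc, Nat.add_sub_cancel] at this
      exact_mod_cast this
    have h6 : (((2 * D).natAbs : ℕ) : ℝ) = 2 * |(D : ℝ)| := by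
      rw [Nat.cast_natAbs]
      push_cast
      rw [abs_mul]
      norm_num
    rw [Finset.sum_const, nsmul_eq_mul, mul_one] at h4
    linarith
  linarith

/-! ### Values of the norm form on a square -/

/-- The points of the square `[0, X]²` other than the origin at which `d` divides `x² - D y²`. -/
def normPoints (D : ℤ) (X : ℕ) (d : ℕ) : Finset (ℕ × ℕ) :=
  ((Finset.range (X + 1) ×ˢ Finset.range (X + 1)).erase (0, 0)).filter
    fun z => (d : ℤ) ∣ (z.1 : ℤ) ^ 2 - D * (z.2 : ℤ) ^ 2

theorem mem_normPoints {D : ℤ} {X d : ℕ} {z : ℕ × ℕ} :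
    z ∈ normPoints D X d ↔ (z ≠ (0, 0) ∧ z.1 ≤ X ∧ z.2 ≤ X) ∧
      (d : ℤ) ∣ (z.1 : ℤ) ^ 2 - D * (z.2 : ℤ) ^ 2 := by
  simp [normPoints]

theorem norm_ne_zero {D : ℤ} (hD : ¬ IsSquare D) {x y : ℤ} (h : ¬ (x = 0 ∧ y = 0)) :
    x ^ 2 - D * y ^ 2 ≠ 0 := by
  intro h0
  by_cases hy : y = 0
  · subst hy
    apply h
    simpa using h0
  · have h1 : y ^ 2 ∣ x ^ 2 := ⟨D, by linarith⟩
    rw [Int.pow_dvd_pow_iff two_ne_zero] at h1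
    obtain ⟨k, rfl⟩ := h1
    apply hD
    refine ⟨k, ?_⟩
    have : y ^ 2 * (k * k - D) = 0 := by linear_combination h0
    rcases mul_eq_zero.1 this with h2 | h2
    · exact absurd (pow_eq_zero_iff two_ne_zero |>.1 h2) hy
    · linarith

theorem div_sub_one_le_card_congruent {p X : ℕ} (hp : 0 < p) (v : ℤ) :
    (X : ℝ) / p - 1 ≤ ((Finset.range (X + 1)).filter fun x : ℕ => (p : ℤ) ∣ (x : ℤ) - v).card := by
  have hp' : (0 : ℤ) < p := by exact_mod_cast hp
  set w : ℕ := (v % p).toNat with hw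
  have hw' : (w : ℤ) = v % p := Int.toNat_of_nonneg (Int.emod_nonneg _ hp'.ne')
  have h1 : ((Finset.range (X + 1)).filter fun x : ℕ => (p : ℤ) ∣ (x : ℤ) - v)
      = (Finset.range (X + 1)).filter (· ≡ w [MOD p]) := by
    refine Finset.filter_congr fun x _ => ?_
    rw [← Int.natCast_modEq_iff, hw', ← Int.modEq_iff_dvd]
    constructor
    · intro h
      exact h.symm.trans (Int.mod_modEq v p).symm
    · intro h
      exact (h.trans (Int.mod_modEq v p)).symm
  rw [h1, ← Nat.count_eq_card_filter_range, Nat.count_modEq_card _ hp]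
  have h2 : (X : ℝ) < p * ((X / p : ℕ) + 1) := by exact_mod_cast Nat.lt_mul_div_succ X hp
  have hp0 : (0 : ℝ) < p := by exact_mod_cast hp
  have h3 : (X : ℝ) / p < (X / p : ℕ) + 1 := by
    rw [div_lt_iff₀ hp0]
    linarith
  have h4 : ((X / p : ℕ) : ℝ) ≤ ((X + 1) / p : ℕ) := by
    exact_mod_cast Nat.div_le_div_right (Nat.le_succ X)
  push_cast
  have h5 : (0 : ℝ) ≤ if w % p < (X + 1) % p then (1 : ℝ) else 0 := by positivity
  linarith

/-- A small split prime divides `x² - D y²` on two residue classes of `x` for each `y` prime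
to it. -/
theorem le_card_normPoints_of_le {D : ℤ} {X p : ℕ} (hp : p ∈ splitPrimes D X) :
    2 * (X : ℝ) ^ 2 / p - 2 * X - 2 * (X : ℝ) ^ 2 / (p : ℝ) ^ 2 ≤ (normPoints D X p).card := by
  obtain ⟨⟨hpX, hpp⟩, ⟨r, hr⟩, h2D⟩ := mem_splitPrimes.1 hp
  have hpZ : Prime (p : ℤ) := Nat.prime_iff_prime_int.1 hpp
  have hp0 : (0 : ℝ) < p := by exact_mod_cast hpp.pos
  have hrp : ¬ (p : ℤ) ∣ 2 * r := by
    intro h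
    apply h2D
    have h3 : (p : ℤ) ∣ 2 * r * r - 2 * (r ^ 2 - D) :=
      dvd_sub (h.mul_right r) (hr.mul_left 2)
    have h4 : 2 * r * r - 2 * (r ^ 2 - D) = 2 * D := by ring
    rwa [h4] at h3
  set F := (Finset.Ioc 0 X).filter fun y => ¬ p ∣ y with hF
  have hFcard : (X : ℝ) - X / p ≤ F.card := by
    have h3 := Finset.card_filter_add_card_filter_not (s := Finset.Ioc 0 X) (fun y => p ∣ y)
    rw [Nat.Ioc_filter_dvd_card_eq_div, Nat.card_Ioc] at h3
    have h4 : ((X / p : ℕ) : ℝ) + F.card = X := by exact_mod_cast h3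
    have h5 : ((X / p : ℕ) : ℝ) ≤ X / p := Nat.cast_div_le
    linarith
  have hfib : ∀ y ∈ F, 2 * ((X : ℝ) / p - 1) ≤
      ((Finset.range (X + 1)).filter
        fun x : ℕ => (p : ℤ) ∣ (x : ℤ) ^ 2 - D * (y : ℤ) ^ 2).card := by
    intro y hy
    have hpy : ¬ (p : ℤ) ∣ y := by
      rw [Int.natCast_dvd_natCast]
      exact (Finset.mem_filter.1 hy).2
    have hdisj : Disjoint
        ((Finset.range (X + 1)).filter fun x : ℕ => (p : ℤ) ∣ (x : ℤ) - r * y)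
        ((Finset.range (X + 1)).filter fun x : ℕ => (p : ℤ) ∣ (x : ℤ) - -(r * y)) := by
      rw [Finset.disjoint_filter]
      intro x _ h3 h4
      have h5 := dvd_sub h4 h3
      have h6 : (x : ℤ) - -(r * y) - (x - r * y) = 2 * r * y := by ring
      rw [h6] at h5
      rcases hpZ.dvd_or_dvd h5 with h | h
      · exact hrp h
      · exact hpy h
    have hsub : ((Finset.range (X + 1)).filter fun x : ℕ => (p : ℤ) ∣ (x : ℤ) - r * y) ∪
        ((Finset.range (X + 1)).filter fun x : ℕ => (p : ℤ) ∣ (x : ℤ) - -(r * y)) ⊆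
        (Finset.range (X + 1)).filter
          fun x : ℕ => (p : ℤ) ∣ (x : ℤ) ^ 2 - D * (y : ℤ) ^ 2 := by
      intro x hx
      have key : (p : ℤ) ∣ ((x : ℤ) - r * y) * (x - -(r * y)) →
          (p : ℤ) ∣ (x : ℤ) ^ 2 - D * (y : ℤ) ^ 2 := by
        intro h
        have h3 := dvd_add h (hr.mul_right ((y : ℤ) ^ 2))
        have h4 : ((x : ℤ) - r * y) * (x - -(r * y)) + (r ^ 2 - D) * (y : ℤ) ^ 2
            = (x : ℤ) ^ 2 - D * (y : ℤ) ^ 2 := by ring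
        rwa [h4] at h3
      rcases Finset.mem_union.1 hx with hx | hx <;> rw [Finset.mem_filter] at hx ⊢
      · exact ⟨hx.1, key (hx.2.mul_right _)⟩
      · exact ⟨hx.1, key (hx.2.mul_left _)⟩
    have h3 := Finset.card_le_card hsub
    rw [Finset.card_union_of_disjoint hdisj] at h3
    have h4 := div_sub_one_le_card_congruent (X := X) hpp.pos (r * y)
    have h5 := div_sub_one_le_card_congruent (X := X) hpp.pos (-(r * y))
    have h6 : (((Finset.range (X + 1)).filter fun x : ℕ => (p : ℤ) ∣ (x : ℤ) - r * y).card : ℝ)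
        + ((Finset.range (X + 1)).filter fun x : ℕ => (p : ℤ) ∣ (x : ℤ) - -(r * y)).card
        ≤ ((Finset.range (X + 1)).filter
          fun x : ℕ => (p : ℤ) ∣ (x : ℤ) ^ 2 - D * (y : ℤ) ^ 2).card := by exact_mod_cast h3
    linarith
  have hcard : ∑ y ∈ F, ((Finset.range (X + 1)).filter
        fun x : ℕ => (p : ℤ) ∣ (x : ℤ) ^ 2 - D * (y : ℤ) ^ 2).card ≤ (normPoints D X p).card := by
    rw [← Finset.card_sigma]
    refine Finset.card_le_card_of_injOn (fun a => (a.2, a.1)) ?_ ?_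
    · rintro ⟨y, x⟩ h
      simp only [Finset.coe_sigma, Set.mem_sigma_iff, Finset.mem_coe, hF, Finset.mem_filter,
        Finset.mem_Ioc, Finset.mem_range] at h
      rw [Finset.mem_coe, mem_normPoints]
      refine ⟨⟨fun h0 => ?_, Nat.lt_succ_iff.1 h.2.1, h.1.1.2⟩, h.2.2⟩
      simp only [Prod.mk.injEq] at h0
      omega
    · rintro ⟨y, x⟩ _ ⟨y', x'⟩ _ h
      simp only [Prod.mk.injEq] at h
      obtain ⟨rfl, rfl⟩ := h
      rfl
  have hX : (0 : ℝ) ≤ (X : ℝ) / p - 1 := by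
    rw [sub_nonneg, le_div_iff₀ hp0, one_mul]
    exact_mod_cast hpX
  have h7 : (F.card : ℝ) * (2 * ((X : ℝ) / p - 1)) ≤ (normPoints D X p).card := by
    refine le_trans ?_ (Nat.cast_le.2 hcard)
    rw [Nat.cast_sum, ← nsmul_eq_mul, ← Finset.sum_const]
    exact Finset.sum_le_sum hfib
  refine le_trans ?_ h7
  refine le_trans ?_ (mul_le_mul_of_nonneg_right hFcard (by linarith))
  have h8 : ((X : ℝ) - X / p) * (2 * ((X : ℝ) / p - 1))
      = 2 * (X : ℝ) ^ 2 / p - 2 * X - 2 * (X : ℝ) ^ 2 / (p : ℝ) ^ 2 + 2 * (X / p) := by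
    field_simp
    ring
  rw [h8]
  have : (0 : ℝ) ≤ X / p := by positivity
  linarith

/-- For a large split prime `p`, the points of the square with `x ≡ r y` modulo `p`, where
`r² ≡ D`, are the differences of points with equal `x - r y`; the pigeonhole principle provides
enough of them. -/
theorem le_card_normPoints_of_lt {D : ℤ} {X n p : ℕ} (hp : p ∈ splitPrimes D n) (hX : X < p) :
    (X : ℝ) ^ 2 / p - 1 ≤ (normPoints D X p).card := by
  obtain ⟨⟨-, hpp⟩, ⟨r, hr⟩, -⟩ := mem_splitPrimes.1 hp
  have : Fact p.Prime := ⟨hpp⟩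
  have hp0 : (0 : ℝ) < p := by exact_mod_cast hpp.pos
  set box := Finset.range (X + 1) ×ˢ Finset.range (X + 1) with hbox
  let φ : ℕ × ℕ → ZMod p := fun z => (z.1 : ZMod p) - (r : ZMod p) * z.2
  obtain ⟨v, -, hv⟩ := Finset.exists_le_card_fiber_of_nsmul_le_card_of_maps_to
    (s := box) (t := (Finset.univ : Finset (ZMod p))) (f := φ) (b := (X : ℝ) ^ 2 / p)
    (fun _ _ => Finset.mem_univ _) Finset.univ_nonempty (by
      rw [Finset.card_univ, ZMod.card, nsmul_eq_mul, mul_div_cancel₀ _ hp0.ne', hbox,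
        Finset.card_product, Finset.card_range]
      push_cast
      nlinarith [(Nat.cast_nonneg X : (0 : ℝ) ≤ X)])
  set S := box.filter fun z => φ z = v with hS
  rcases S.eq_empty_or_nonempty with h0 | hne
  · rw [h0, Finset.card_empty, Nat.cast_zero] at hv
    linarith [(Nat.cast_nonneg _ : (0 : ℝ) ≤ (normPoints D X p).card)]
  obtain ⟨z₀, hz₀, hmin⟩ := Finset.exists_min_image S (fun z => z.2) hne
  have hmem : ∀ z, z ∈ S ↔ (z.1 ≤ X ∧ z.2 ≤ X) ∧ φ z = v := by
    intro z
    simp [hS, hbox]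
  have hdiff : ∀ z ∈ S, ∀ w ∈ S, (p : ℤ) ∣ ((z.1 : ℤ) - w.1) - r * ((z.2 : ℤ) - w.2) := by
    intro z hz w hw
    have h : φ z = φ w := ((hmem z).1 hz).2.trans ((hmem w).1 hw).2.symm
    rw [← ZMod.intCast_zmod_eq_zero_iff_dvd]
    push_cast
    linear_combination h
  -- within a fibre the second coordinate determines the first
  have hinj : ∀ z ∈ S, ∀ w ∈ S, z.2 = w.2 → z = w := by
    intro z hz w hw h2
    have h := hdiff z hz w hw
    rw [h2, sub_self, mul_zero, sub_zero] at h
    have hzX := ((hmem z).1 hz).1.1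
    have hwX := ((hmem w).1 hw).1.1
    have h3 : (z.1 : ℤ) - w.1 = 0 := by
      refine Int.eq_zero_of_abs_lt_dvd h ?_
      rw [abs_lt]
      constructor <;> omega
    exact Prod.ext (by omega) h2
  have hcard : (S.erase z₀).card ≤ (normPoints D X p).card := by
    refine Finset.card_le_card_of_injOn
      (fun z => (((z.1 : ℤ) - z₀.1).natAbs, ((z.2 : ℤ) - z₀.2).natAbs)) ?_ ?_
    · intro z hz
      rw [Finset.mem_coe, Finset.mem_erase] at hz
      have hzX := ((hmem z).1 hz.2).1
      have hwX := ((hmem z₀).1 hz₀).1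
      rw [Finset.mem_coe, mem_normPoints]
      refine ⟨⟨?_, ?_, ?_⟩, ?_⟩
      · intro h
        simp only [Prod.mk.injEq, Int.natAbs_eq_zero] at h
        exact hz.1 (hinj z hz.2 z₀ hz₀ (by omega))
      · show ((z.1 : ℤ) - z₀.1).natAbs ≤ X
        omega
      · show ((z.2 : ℤ) - z₀.2).natAbs ≤ X
        omega
      · show (p : ℤ) ∣ ((((z.1 : ℤ) - z₀.1).natAbs : ℕ) : ℤ) ^ 2
          - D * ((((z.2 : ℤ) - z₀.2).natAbs : ℕ) : ℤ) ^ 2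
        rw [Int.natAbs_sq, Int.natAbs_sq]
        have h := hdiff z hz.2 z₀ hz₀
        have h3 := dvd_add (h.mul_right (((z.1 : ℤ) - z₀.1) + r * ((z.2 : ℤ) - z₀.2)))
          (hr.mul_right (((z.2 : ℤ) - z₀.2) ^ 2))
        have h4 : ((z.1 : ℤ) - z₀.1 - r * (z.2 - z₀.2)) * (z.1 - z₀.1 + r * (z.2 - z₀.2))
            + (r ^ 2 - D) * ((z.2 : ℤ) - z₀.2) ^ 2
            = ((z.1 : ℤ) - z₀.1) ^ 2 - D * ((z.2 : ℤ) - z₀.2) ^ 2 := by ring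
        rwa [h4] at h3
    · intro z hz w hw h
      rw [Finset.mem_coe, Finset.mem_erase] at hz hw
      have hz2 := hmin z hz.2
      have hw2 := hmin w hw.2
      simp only [Prod.mk.injEq] at h
      exact hinj z hz.2 w hw.2 (by omega)
  rw [Finset.card_erase_of_mem hz₀] at hcard
  have h1 : (S.card : ℝ) ≤ (normPoints D X p).card + 1 := by
    exact_mod_cast (by omega : S.card ≤ (normPoints D X p).card + 1)
  linarith

theorem normPoints_card_le (D : ℤ) (X d : ℕ) : (normPoints D X d).card ≤ X ^ 2 + 2 * X := by
  refine (Finset.card_filter_le _ _).trans ?_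
  rw [Finset.card_erase_of_mem (by simp), Finset.card_product, Finset.card_range]
  have : (X + 1) * (X + 1) = X ^ 2 + 2 * X + 1 := by ring
  omega

/-- Compare the product of the values `x² - D y²` over the nonzero points of `[0, X]²` with the
contribution of the split primes up to `X²` to it. -/
theorem sum_splitPrimes_mul_card_le {D : ℤ} (hD : ¬ IsSquare D) {X : ℕ} (hX : 1 ≤ X) :
    ∑ p ∈ splitPrimes D (X ^ 2), Real.log p * (normPoints D X p).card
      ≤ ((X : ℝ) ^ 2 + 2 * X) * (2 * Real.log X + Real.log (1 + |(D : ℝ)|)) := by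
  classical
  have hX0 : (1 : ℝ) ≤ X := by exact_mod_cast hX
  set V : ℕ × ℕ → ℕ := fun z => ((z.1 : ℤ) ^ 2 - D * (z.2 : ℤ) ^ 2).natAbs with hV
  set Q := normPoints D X 1 with hQ
  have hV0 : ∀ z ∈ Q, V z ≠ 0 := by
    intro z hz
    rw [hV]
    simp only [ne_eq, Int.natAbs_eq_zero]
    refine norm_ne_zero hD fun h => (mem_normPoints.1 hz).1.1 (Prod.ext ?_ ?_)
    · exact_mod_cast h.1
    · exact_mod_cast h.2
  have h1 : ∑ p ∈ splitPrimes D (X ^ 2), Real.log p * (normPoints D X p).card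
      = ∑ z ∈ Q, ∑ p ∈ (splitPrimes D (X ^ 2)).filter (fun p => p ∣ V z), Real.log p := by
    have h2 : ∀ p : ℕ, Real.log p * (normPoints D X p).card
        = ∑ z ∈ Q, if p ∣ V z then Real.log p else 0 := by
      intro p
      rw [← Finset.sum_filter, Finset.sum_const, nsmul_eq_mul, mul_comm]
      congr 3
      ext z
      simp only [Finset.mem_filter, hQ, mem_normPoints, hV, Nat.cast_one, one_dvd, and_true,
        Int.natCast_dvd]
    simp_rw [h2]
    rw [Finset.sum_comm]
    exact Finset.sum_congr rfl fun z _ => (Finset.sum_filter _ _).symm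
  have h2 : ∀ z ∈ Q, ∑ p ∈ (splitPrimes D (X ^ 2)).filter (fun p => p ∣ V z), Real.log p
      ≤ 2 * Real.log X + Real.log (1 + |(D : ℝ)|) := by
    intro z hz
    have hz' := (mem_normPoints.1 hz).1.2
    refine (sum_log_primes_le_log (hV0 z hz) _ fun p hp => ?_).trans ?_
    · rw [Finset.mem_filter, mem_splitPrimes] at hp
      exact ⟨hp.1.1.2, hp.2⟩
    · have h3 : (V z : ℝ) ≤ (X : ℝ) ^ 2 * (1 + |(D : ℝ)|) := by
        rw [hV, Nat.cast_natAbs]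
        push_cast
        have hx : (z.1 : ℝ) ≤ X := by exact_mod_cast hz'.1
        have hy : (z.2 : ℝ) ≤ X := by exact_mod_cast hz'.2
        have hx2 : (z.1 : ℝ) ^ 2 ≤ X ^ 2 := pow_le_pow_left₀ (Nat.cast_nonneg _) hx 2
        have hy2 : (z.2 : ℝ) ^ 2 ≤ X ^ 2 := pow_le_pow_left₀ (Nat.cast_nonneg _) hy 2
        refine (abs_sub _ _).trans ?_
        rw [abs_mul, abs_of_nonneg (sq_nonneg (z.1 : ℝ)), abs_of_nonneg (sq_nonneg (z.2 : ℝ))]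
        nlinarith [mul_le_mul_of_nonneg_left hy2 (abs_nonneg (D : ℝ))]
      have h4 : (0 : ℝ) < V z := by exact_mod_cast Nat.pos_of_ne_zero (hV0 z hz)
      refine (Real.log_le_log h4 h3).trans (le_of_eq ?_)
      rw [Real.log_mul (by positivity) (by positivity), Real.log_pow]
      push_cast
      ring
  have h3 : 0 ≤ 2 * Real.log X + Real.log (1 + |(D : ℝ)|) := by
    have h4 : 0 ≤ Real.log (1 + |(D : ℝ)|) :=
      Real.log_nonneg (by linarith [abs_nonneg (D : ℝ)])
    linarith [Real.log_natCast_nonneg X]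
  rw [h1]
  refine (Finset.sum_le_sum h2).trans ?_
  rw [Finset.sum_const, nsmul_eq_mul]
  refine mul_le_mul_of_nonneg_right ?_ h3
  exact_mod_cast normPoints_card_le D X 1

/-- If almost all primes were split, the left side would be close to `3 * log X`. -/
theorem sum_splitPrimes_add_sum_splitPrimes_sq_le {D : ℤ} (hD : ¬ IsSquare D) {X : ℕ}
    (hX : 1 ≤ X) :
    ∑ p ∈ splitPrimes D X, Real.log p / p + ∑ p ∈ splitPrimes D (X ^ 2), Real.log p / p
      ≤ 2 * Real.log X + 3 * Real.log (1 + |(D : ℝ)|) + 13 := by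
  have hX0 : (1 : ℝ) ≤ X := by exact_mod_cast hX
  have hXpos : (0 : ℝ) < X := by linarith
  have hsub := splitPrimes_mono D (show X ≤ X ^ 2 by nlinarith)
  have h1 := sum_splitPrimes_mul_card_le hD hX
  rw [← Finset.sum_sdiff hsub] at h1
  have h2 : ∑ p ∈ splitPrimes D X, (2 * (X : ℝ) ^ 2 * (Real.log p / p) - 2 * X * Real.log p
      - 2 * (X : ℝ) ^ 2 * (Real.log p / (p : ℝ) ^ 2))
      ≤ ∑ p ∈ splitPrimes D X, Real.log p * (normPoints D X p).card := by
    refine Finset.sum_le_sum fun p hp => ?_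
    refine le_trans (le_of_eq ?_) (mul_le_mul_of_nonneg_left (le_card_normPoints_of_le hp)
      (Real.log_natCast_nonneg p))
    ring
  have h3 : ∑ p ∈ splitPrimes D (X ^ 2) \ splitPrimes D X,
      ((X : ℝ) ^ 2 * (Real.log p / p) - Real.log p)
      ≤ ∑ p ∈ splitPrimes D (X ^ 2) \ splitPrimes D X, Real.log p * (normPoints D X p).card := by
    refine Finset.sum_le_sum fun p hp => ?_
    rw [Finset.mem_sdiff] at hp
    have hXp : X < p := by
      by_contra h
      exact hp.2 (mem_splitPrimes.2 ⟨⟨by omega, (mem_splitPrimes.1 hp.1).1.2⟩,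
        (mem_splitPrimes.1 hp.1).2⟩)
    refine le_trans (le_of_eq ?_) (mul_le_mul_of_nonneg_left (le_card_normPoints_of_lt hp.1 hXp)
      (Real.log_natCast_nonneg p))
    ring
  rw [Finset.sum_sub_distrib, Finset.sum_sub_distrib, ← Finset.mul_sum, ← Finset.mul_sum,
    ← Finset.mul_sum] at h2
  rw [Finset.sum_sub_distrib, ← Finset.mul_sum] at h3
  have h4 : ∑ p ∈ splitPrimes D X, Real.log p ≤ Real.log 4 * X :=
    (Finset.sum_le_sum_of_subset_of_nonneg (splitPrimes_subset_primesLE D X)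
      fun p _ _ => Real.log_natCast_nonneg p).trans (sum_log_primesLE_le X)
  have h5 : ∑ p ∈ splitPrimes D (X ^ 2) \ splitPrimes D X, Real.log p
      ≤ Real.log 4 * (X : ℝ) ^ 2 := by
    have h := sum_log_primesLE_le (X ^ 2)
    push_cast at h
    exact (Finset.sum_le_sum_of_subset_of_nonneg
      (Finset.sdiff_subset.trans (splitPrimes_subset_primesLE D (X ^ 2)))
      fun p _ _ => Real.log_natCast_nonneg p).trans h
  have h6 : ∑ p ∈ splitPrimes D X, Real.log p / (p : ℝ) ^ 2 ≤ 2 :=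
    (Finset.sum_le_sum_of_subset_of_nonneg (splitPrimes_subset_primesLE D X)
      fun p _ _ => div_nonneg (Real.log_natCast_nonneg p) (by positivity)).trans
      (sum_primesLE_log_div_sq_le X)
  have h7 : ∑ p ∈ splitPrimes D (X ^ 2) \ splitPrimes D X, Real.log p / p
      = ∑ p ∈ splitPrimes D (X ^ 2), Real.log p / p - ∑ p ∈ splitPrimes D X, Real.log p / p := by
    rw [← Finset.sum_sdiff hsub]
    ring
  rw [h7] at h3
  set S₁ := ∑ p ∈ splitPrimes D X, Real.log p / p
  set S₂ := ∑ p ∈ splitPrimes D (X ^ 2), Real.log p / p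
  have h8 : 0 ≤ Real.log (1 + |(D : ℝ)|) :=
    Real.log_nonneg (by linarith [abs_nonneg (D : ℝ)])
  have h9 : Real.log X ≤ X := (Real.log_le_sub_one_of_pos hXpos).trans (by linarith)
  have h10 := log_four_le
  have h11 : (X : ℝ) ^ 2 * (S₁ + S₂)
      ≤ X ^ 2 * (2 * Real.log X + 3 * Real.log (1 + |(D : ℝ)|) + 13) := by
    have e1 : X * Real.log X ≤ (X : ℝ) ^ 2 := by nlinarith
    have e2 : X * Real.log (1 + |(D : ℝ)|) ≤ (X : ℝ) ^ 2 * Real.log (1 + |(D : ℝ)|) :=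
      mul_le_mul_of_nonneg_right (by nlinarith) h8
    have e3 : 2 * (X : ℝ) * ∑ p ∈ splitPrimes D X, Real.log p ≤ 2.8 * (X : ℝ) ^ 2 := by
      have : 2 * (X : ℝ) * ∑ p ∈ splitPrimes D X, Real.log p ≤ 2 * X * (1.4 * X) :=
        mul_le_mul_of_nonneg_left (h4.trans (mul_le_mul_of_nonneg_right h10 hXpos.le))
          (by linarith)
      linarith
    have e4 : 2 * (X : ℝ) ^ 2 * ∑ p ∈ splitPrimes D X, Real.log p / (p : ℝ) ^ 2
        ≤ 2 * (X : ℝ) ^ 2 * 2 := mul_le_mul_of_nonneg_left h6 (by positivity)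
    have e5 : Real.log 4 * (X : ℝ) ^ 2 ≤ 1.4 * (X : ℝ) ^ 2 :=
      mul_le_mul_of_nonneg_right h10 (by positivity)
    nlinarith
  exact le_of_mul_le_mul_left h11 (by positivity)

/-- The inert primes have a positive share among all primes, in the logarithmic sense. -/
theorem log_le_sum_inertPrimes_sq {D : ℤ} (hD : ¬ IsSquare D) {X : ℕ} (hX : 1 ≤ X) :
    Real.log X ≤ 19 + 7 * |(D : ℝ)| + 2 * ∑ p ∈ inertPrimes D (X ^ 2), Real.log p / p := by
  have hD0 : D ≠ 0 := by
    rintro rfl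
    exact hD (IsSquare.zero)
  have h1 := sum_splitPrimes_add_sum_splitPrimes_sq_le hD hX
  have h2 := log_sub_le_sum_splitPrimes hD0 hX
  have h3 := log_sub_le_sum_splitPrimes hD0 (n := X ^ 2) (Nat.one_le_pow _ _ hX)
  have h4 := sum_inertPrimes_mono D (show X ≤ X ^ 2 by nlinarith)
  have h5 : Real.log (1 + |(D : ℝ)|) ≤ |(D : ℝ)| :=
    (Real.log_le_sub_one_of_pos (by positivity)).trans (by linarith)
  rw [Nat.cast_pow, Real.log_pow] at h3
  push_cast at h3
  linarith

/-! ### Large prime factors of `(2j + ε)² - D` -/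

/-- In a family of nonzero integers the `p`-adic valuations other than the largest one are bounded
by those of the differences with the member of largest valuation. -/
theorem exists_sum_factorization_le {J : Finset ℕ} (hJ : J.Nonempty) {N : ℕ → ℤ}
    (hne : ∀ i ∈ J, ∀ j ∈ J, i ≠ j → N i ≠ N j) {p : ℕ} (hp : p.Prime) :
    ∃ j₀ ∈ J, ∑ j ∈ J, (N j).natAbs.factorization p ≤ (N j₀).natAbs.factorization p +
      (∏ j ∈ J.erase j₀, (N j - N j₀).natAbs).factorization p := by
  obtain ⟨j₀, hj₀, hmax⟩ := Finset.exists_max_image J (fun j => (N j).natAbs.factorization p) hJ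
  refine ⟨j₀, hj₀, ?_⟩
  have h0 : ∀ j ∈ J.erase j₀, (N j - N j₀).natAbs ≠ 0 := by
    intro j hj
    rw [Finset.mem_erase] at hj
    rw [Int.natAbs_ne_zero, sub_ne_zero]
    exact hne j hj.2 j₀ hj₀ hj.1
  rw [← Finset.add_sum_erase J _ hj₀, Nat.factorization_prod_apply h0]
  refine Nat.add_le_add_left (Finset.sum_le_sum fun j hj => ?_) _
  rw [← hp.pow_dvd_iff_le_factorization (h0 j hj), ← Int.natCast_dvd]
  refine dvd_sub ?_ ?_ <;> rw [Int.natCast_dvd]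
  · exact Nat.ordProj_dvd _ _
  · exact (pow_dvd_pow p (hmax j (Finset.mem_of_mem_erase hj))).trans (Nat.ordProj_dvd _ _)

theorem prod_erase_natAbs_sub_dvd_factorial {A Y j₀ : ℕ} (h : j₀ ∈ Finset.Ico A (A + Y)) :
    ∏ j ∈ (Finset.Ico A (A + Y)).erase j₀, ((j : ℤ) - j₀).natAbs ∣ Y.factorial := by
  rw [Finset.mem_Ico] at h
  have hsplit : (Finset.Ico A (A + Y)).erase j₀
      = Finset.Ico A j₀ ∪ Finset.Ico (j₀ + 1) (A + Y) := by
    ext j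
    simp only [Finset.mem_erase, Finset.mem_Ico, Finset.mem_union]
    omega
  have hdisj : Disjoint (Finset.Ico A j₀) (Finset.Ico (j₀ + 1) (A + Y)) := by
    rw [Finset.disjoint_left]
    intro j h1 h2
    rw [Finset.mem_Ico] at h1 h2
    omega
  have h1 : ∏ j ∈ Finset.Ico A j₀, ((j : ℤ) - j₀).natAbs = (j₀ - A).factorial := by
    rw [Finset.prod_Ico_eq_prod_range, ← Nat.descFactorial_self, Nat.descFactorial_eq_prod_range]
    refine Finset.prod_congr rfl fun i hi => ?_
    rw [Finset.mem_range] at hi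
    omega
  have h2 : ∏ j ∈ Finset.Ico (j₀ + 1) (A + Y), ((j : ℤ) - j₀).natAbs
      = (A + Y - (j₀ + 1)).factorial := by
    rw [Finset.prod_Ico_eq_prod_range, ← Finset.prod_range_add_one_eq_factorial]
    refine Finset.prod_congr rfl fun i hi => ?_
    omega
  rw [hsplit, Finset.prod_union hdisj, h1, h2]
  exact (Nat.factorial_mul_factorial_dvd_factorial_add _ _).trans
    (Nat.factorial_dvd_factorial (by omega))

theorem prod_erase_add_dvd {A Y j₀ e : ℕ} (hA : 1 ≤ A) :
    ∏ j ∈ (Finset.Ico A (A + Y)).erase j₀, (j + j₀ + e) ∣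
      Y.factorial * (A + j₀ + e - 1 + Y).choose Y := by
  refine (Finset.prod_dvd_prod_of_subset _ _ _ (Finset.erase_subset _ _)).trans (dvd_of_eq ?_)
  rw [← Nat.ascFactorial_eq_factorial_mul_choose, Nat.ascFactorial_eq_prod_range,
    Finset.prod_Ico_eq_prod_range, Nat.add_sub_cancel_left]
  refine Finset.prod_congr rfl fun i _ => ?_
  omega

/-- The values `(2j + e)² - D` have differences `4 (i - j) (i + j + e)`. -/
theorem factorization_prod_differences_le {D : ℤ} {A Y j₀ e p : ℕ} (hA : 1 ≤ A)
    (h : j₀ ∈ Finset.Ico A (A + Y)) :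
    (∏ j ∈ (Finset.Ico A (A + Y)).erase j₀,
      (((2 * j + e : ℤ) ^ 2 - D) - ((2 * j₀ + e : ℤ) ^ 2 - D)).natAbs).factorization p
    ≤ (4 ^ Y).factorization p + 2 * Y.factorial.factorization p +
      ((A + j₀ + e - 1 + Y).choose Y).factorization p := by
  have h1 : ∏ j ∈ (Finset.Ico A (A + Y)).erase j₀,
      (((2 * j + e : ℤ) ^ 2 - D) - ((2 * j₀ + e : ℤ) ^ 2 - D)).natAbs
      = 4 ^ (Y - 1) * (∏ j ∈ (Finset.Ico A (A + Y)).erase j₀, ((j : ℤ) - j₀).natAbs) *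
        ∏ j ∈ (Finset.Ico A (A + Y)).erase j₀, (j + j₀ + e) := by
    have hc : ((Finset.Ico A (A + Y)).erase j₀).card = Y - 1 := by
      rw [Finset.card_erase_of_mem h, Nat.card_Ico, Nat.add_sub_cancel_left]
    rw [← hc, ← Finset.prod_const, ← Finset.prod_mul_distrib, ← Finset.prod_mul_distrib]
    refine Finset.prod_congr rfl fun j _ => ?_
    have h2 : ((2 * j + e : ℤ) ^ 2 - D) - ((2 * j₀ + e : ℤ) ^ 2 - D)
        = 4 * ((j : ℤ) - j₀) * ((j + j₀ + e : ℕ) : ℤ) := by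
      push_cast
      ring
    rw [h2, Int.natAbs_mul, Int.natAbs_mul, Int.natAbs_natCast]
    rfl
  have h2 : ∏ j ∈ (Finset.Ico A (A + Y)).erase j₀,
      (((2 * j + e : ℤ) ^ 2 - D) - ((2 * j₀ + e : ℤ) ^ 2 - D)).natAbs
      ∣ 4 ^ Y * Y.factorial * (Y.factorial * (A + j₀ + e - 1 + Y).choose Y) := by
    rw [h1]
    exact mul_dvd_mul (mul_dvd_mul (pow_dvd_pow 4 (Nat.sub_le _ _))
      (prod_erase_natAbs_sub_dvd_factorial h)) (prod_erase_add_dvd hA)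
  have hc0 : (A + j₀ + e - 1 + Y).choose Y ≠ 0 := (Nat.choose_pos (Nat.le_add_left _ _)).ne'
  have hY0 := Nat.factorial_ne_zero Y
  have h40 : 4 ^ Y ≠ 0 := pow_ne_zero _ (by norm_num)
  have h3 := (Nat.factorization_le_iff_dvd (ne_zero_of_dvd_ne_zero (by positivity) h2)
    (by positivity)).2 h2 p
  refine h3.trans (le_of_eq ?_)
  rw [Nat.factorization_mul (by positivity) (by positivity), Nat.factorization_mul h40 hY0,
    Nat.factorization_mul hY0 hc0]
  simp only [Finsupp.add_apply]
  ring

/-- The total contribution of one prime to the values `(2j + e)² - D` on an interval: twice its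
contribution to `Y!`, up to a logarithmic error and a share of `4 ^ Y`. -/
theorem sum_factorization_mul_log_le {D : ℤ} (hD : ¬ IsSquare D) {A Y e p : ℕ} (hY : 1 ≤ Y)
    (hYA : Y ≤ A) (he : e ≤ 1) (hp : p.Prime) {B : ℝ}
    (hB : ∀ j ∈ Finset.Ico A (A + Y), ((((2 * j + e : ℤ) ^ 2 - D).natAbs : ℕ) : ℝ) ≤ B) :
    ∑ j ∈ Finset.Ico A (A + Y),
        (((2 * j + e : ℤ) ^ 2 - D).natAbs.factorization p : ℝ) * Real.log p
      ≤ ((4 ^ Y).factorization p : ℝ) * Real.log p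
        + 2 * ((Y.factorial.factorization p : ℝ) * Real.log p)
        + (Real.log B + Real.log (3 * (A + Y : ℕ))) := by
  have hval : ∀ j : ℕ, ((2 * j + e : ℤ) ^ 2 - D) ≠ 0 := by
    intro j h
    exact hD ⟨2 * j + e, by linarith⟩
  obtain ⟨j₀, hj₀, hsum⟩ := exists_sum_factorization_le
    (J := Finset.Ico A (A + Y)) (N := fun j => (2 * j + e : ℤ) ^ 2 - D)
    (Finset.nonempty_Ico.2 (by omega)) (by
      intro i hi j hj hij h
      rw [Finset.mem_Ico] at hi hj
      have h2 : ((i : ℤ) - j) * (4 * (i + j + e)) = 0 := by linear_combination h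
      rcases mul_eq_zero.1 h2 with h3 | h3 <;> omega) hp
  have h1 := hsum.trans (Nat.add_le_add_left
    (factorization_prod_differences_le (D := D) (p := p) (e := e) (by omega) hj₀) _)
  have hlog : 0 ≤ Real.log p := Real.log_natCast_nonneg p
  have hpart : ∀ {n : ℕ} {x : ℝ}, n ≠ 0 → ((p ^ n.factorization p : ℕ) : ℝ) ≤ x →
      (n.factorization p : ℝ) * Real.log p ≤ Real.log x := by
    intro n x _ hx
    rw [← Real.log_pow]
    refine Real.log_le_log (pow_pos (by exact_mod_cast hp.pos) _) ?_
    exact_mod_cast hx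
  have h2 : (((2 * j₀ + e : ℤ) ^ 2 - D).natAbs.factorization p : ℝ) * Real.log p ≤ Real.log B := by
    refine hpart (Int.natAbs_ne_zero.2 (hval j₀)) (le_trans ?_ (hB j₀ hj₀))
    exact_mod_cast Nat.ordProj_le p (Int.natAbs_ne_zero.2 (hval j₀))
  have h3 : (((A + j₀ + e - 1 + Y).choose Y).factorization p : ℝ) * Real.log p
      ≤ Real.log (3 * (A + Y : ℕ)) := by
    refine hpart (Nat.choose_pos (Nat.le_add_left _ _)).ne' ?_
    have h4 := Nat.pow_factorization_choose_le (p := p) (k := Y)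
      (show 0 < A + j₀ + e - 1 + Y by omega)
    rw [Finset.mem_Ico] at hj₀
    exact_mod_cast h4.trans (by omega : A + j₀ + e - 1 + Y ≤ 3 * (A + Y))
  have h5 := mul_le_mul_of_nonneg_right (Nat.cast_le (α := ℝ).2 h1) hlog
  push_cast at h5
  rw [Finset.sum_mul] at h5
  refine h5.trans ?_
  linarith

/-- If the values `(2j + e)² - D` on an interval are products of small primes only, then the inert
primes, which divide none of them, are sparse. -/
theorem sum_inertPrimes_le_of_smooth {D : ℤ} (hD : ¬ IsSquare D) {A Y e L : ℕ} (hY : 2 ≤ Y)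
    (hYA : Y ≤ A) (he : e ≤ 1) (hL : 1 ≤ L) (hAL : A + Y ≤ L * Y) (hDL : |D| ≤ L) (hLY : L ≤ Y)
    (hsmooth : ∀ j ∈ Finset.Ico A (A + Y), ∀ p : ℕ, p.Prime →
      (p : ℤ) ∣ (2 * j + e : ℤ) ^ 2 - D → p ≤ L * Y) :
    ∑ p ∈ inertPrimes D Y, Real.log p / p ≤ 23 * L := by
  set J := Finset.Ico A (A + Y) with hJ
  set Z := L * Y with hZ
  have hval : ∀ j : ℕ, ((2 * j + e : ℤ) ^ 2 - D) ≠ 0 := by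
    intro j h
    exact hD ⟨2 * j + e, by linarith⟩
  have hYZ : Y ≤ Z := by nlinarith
  have hY0 : (2 : ℝ) ≤ Y := by exact_mod_cast hY
  have hZ0 : (2 : ℝ) ≤ Z := by exact_mod_cast hY.trans hYZ
  have hlogY : 0 ≤ Real.log Y := Real.log_natCast_nonneg Y
  -- size of the values
  have hsize : ∀ j ∈ J, (Y : ℤ) ^ 2 ≤ (2 * j + e : ℤ) ^ 2 - D ∧
      (2 * j + e : ℤ) ^ 2 - D ≤ 5 * (Z : ℤ) ^ 2 := by
    intro j hj
    rw [hJ, Finset.mem_Ico] at hj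
    have h1 : (Y : ℤ) ≤ j := by omega
    have h2 : (2 * j + e : ℤ) ≤ 2 * Z := by omega
    have h3 := abs_le.1 hDL
    have h4 : (L : ℤ) ≤ Y := by exact_mod_cast hLY
    have h5 : (Y : ℤ) ≤ Z := by exact_mod_cast hYZ
    constructor <;> nlinarith
  have hB : ∀ j ∈ J, ((((2 * j + e : ℤ) ^ 2 - D).natAbs : ℕ) : ℝ) ≤ 5 * (Z : ℝ) ^ 2 := by
    intro j hj
    have h1 := hsize j hj
    rw [Nat.cast_natAbs, abs_of_nonneg (le_trans (by positivity) h1.1)]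
    exact_mod_cast h1.2
  have hlow : (Y : ℝ) * (2 * Real.log Y) ≤
      ∑ j ∈ J, Real.log (((2 * j + e : ℤ) ^ 2 - D).natAbs : ℕ) := by
    have hc : J.card = Y := by rw [hJ, Nat.card_Ico, Nat.add_sub_cancel_left]
    nth_rw 1 [← hc]
    rw [← nsmul_eq_mul, ← Finset.sum_const]
    refine Finset.sum_le_sum fun j hj => ?_
    have h1 := hsize j hj
    have h2 : (2 : ℝ) * Real.log Y = Real.log ((Y : ℝ) ^ 2) := by rw [Real.log_pow]; norm_num
    rw [h2]
    refine Real.log_le_log (by positivity) ?_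
    rw [Nat.cast_natAbs, abs_of_nonneg (le_trans (by positivity) h1.1)]
    exact_mod_cast h1.1
  have hsum : ∑ j ∈ J, Real.log (((2 * j + e : ℤ) ^ 2 - D).natAbs : ℕ)
      = ∑ p ∈ Nat.primesLE Z, ∑ j ∈ J,
        (((2 * j + e : ℤ) ^ 2 - D).natAbs.factorization p : ℝ) * Real.log p := by
    rw [Finset.sum_comm]
    refine Finset.sum_congr rfl fun j hj => log_eq_sum_primesLE fun p hp hpd => ?_
    exact hsmooth j hj p hp (Int.natCast_dvd.2 hpd)
  set E := Real.log (5 * (Z : ℝ) ^ 2) + Real.log (3 * (A + Y : ℕ)) with hE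
  have hE0 : 0 ≤ E := by
    refine add_nonneg (Real.log_nonneg (by nlinarith)) (Real.log_nonneg ?_)
    have : (1 : ℝ) ≤ (A + Y : ℕ) := by exact_mod_cast (by omega : 1 ≤ A + Y)
    linarith
  have hElog : E ≤ 7 * Real.log Z := by
    have h2 : (7 : ℝ) * Real.log Z = Real.log ((Z : ℝ) ^ 7) := by rw [Real.log_pow]; norm_num
    have hAZ : ((A + Y : ℕ) : ℝ) ≤ Z := by exact_mod_cast hAL
    have hpos : (0 : ℝ) < (A + Y : ℕ) := by exact_mod_cast (by omega : 0 < A + Y)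
    have h1 : E = Real.log (5 * (Z : ℝ) ^ 2 * (3 * (A + Y : ℕ))) :=
      (Real.log_mul (by positivity) (by positivity)).symm
    rw [h1, h2]
    refine Real.log_le_log (by positivity) ?_
    have h3 : (16 : ℝ) ≤ (Z : ℝ) ^ 4 := by
      calc (16 : ℝ) = 2 ^ 4 := by norm_num
        _ ≤ (Z : ℝ) ^ 4 := pow_le_pow_left₀ (by norm_num) hZ0 4
    have h4 : (0 : ℝ) ≤ (Z : ℝ) ^ 3 := by positivity
    calc 5 * (Z : ℝ) ^ 2 * (3 * (A + Y : ℕ)) ≤ 5 * (Z : ℝ) ^ 2 * (3 * Z) := by gcongr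
      _ = 15 * (Z : ℝ) ^ 3 := by ring
      _ ≤ (Z : ℝ) ^ 4 * (Z : ℝ) ^ 3 := by nlinarith
      _ = (Z : ℝ) ^ 7 := by ring
  have hinert : inertPrimes D Y ⊆ Nat.primesLE Z :=
    (inertPrimes_mono D hYZ).trans (inertPrimes_subset_primesLE D Z)
  have hnon : ∀ p ∈ inertPrimes D Y, ∑ j ∈ J,
      (((2 * j + e : ℤ) ^ 2 - D).natAbs.factorization p : ℝ) * Real.log p = 0 := by
    intro p hp
    refine Finset.sum_eq_zero fun j _ => ?_
    rw [Nat.factorization_eq_zero_of_not_dvd, Nat.cast_zero, zero_mul]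
    rw [← Int.natCast_dvd]
    exact (mem_inertPrimes.1 hp).2 _
  have hup : ∑ p ∈ Nat.primesLE Z, ∑ j ∈ J,
        (((2 * j + e : ℤ) ^ 2 - D).natAbs.factorization p : ℝ) * Real.log p
      ≤ Y * Real.log 4 + 2 * (Y * Real.log Y) + (Nat.primesLE Z).card * E
        - 2 * ∑ p ∈ inertPrimes D Y, (Y.factorial.factorization p : ℝ) * Real.log p := by
    have h1 : ∑ p ∈ Nat.primesLE Z \ inertPrimes D Y, ∑ j ∈ J,
        (((2 * j + e : ℤ) ^ 2 - D).natAbs.factorization p : ℝ) * Real.log p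
        ≤ ∑ p ∈ Nat.primesLE Z \ inertPrimes D Y, (((4 ^ Y).factorization p : ℝ) * Real.log p
          + 2 * ((Y.factorial.factorization p : ℝ) * Real.log p) + E) := by
      refine Finset.sum_le_sum fun p hp => ?_
      have hpp := (Nat.mem_primesLE.1 (Finset.mem_sdiff.1 hp).1).2
      exact sum_factorization_mul_log_le hD (by omega) hYA he hpp hB
    have hnn : ∀ p n : ℕ, 0 ≤ (n.factorization p : ℝ) * Real.log p := fun p n =>
      mul_nonneg (Nat.cast_nonneg _) (Real.log_natCast_nonneg p)
    have h2 : ∑ p ∈ Nat.primesLE Z \ inertPrimes D Y, ((4 ^ Y).factorization p : ℝ) * Real.log p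
        ≤ Y * Real.log 4 := by
      have h3 := log_eq_sum_primesLE (N := 4 ^ Y) (Z := Z) fun p hp h => by
        have h4 : p ∣ 2 := hp.dvd_of_dvd_pow (n := 2) (hp.dvd_of_dvd_pow h)
        exact (Nat.le_of_dvd two_pos h4).trans (hY.trans hYZ)
      push_cast at h3
      rw [Real.log_pow] at h3
      rw [h3]
      exact Finset.sum_le_sum_of_subset_of_nonneg Finset.sdiff_subset fun p _ _ => hnn p _
    have h4 : ∑ p ∈ Nat.primesLE Z \ inertPrimes D Y,
        (Y.factorial.factorization p : ℝ) * Real.log p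
        ≤ Y * Real.log Y
          - ∑ p ∈ inertPrimes D Y, (Y.factorial.factorization p : ℝ) * Real.log p := by
      rw [le_sub_iff_add_le, Finset.sum_sdiff hinert,
        ← log_eq_sum_primesLE (N := Y.factorial) (Z := Z)
          fun p hp h => ((hp.dvd_factorial).1 h).trans hYZ, ← Real.log_pow]
      refine Real.log_le_log (by exact_mod_cast Nat.factorial_pos Y) ?_
      exact_mod_cast Nat.factorial_le_pow Y
    have h5 : ∑ p ∈ Nat.primesLE Z \ inertPrimes D Y, E ≤ (Nat.primesLE Z).card * E := by
      rw [Finset.sum_const, nsmul_eq_mul]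
      exact mul_le_mul_of_nonneg_right
        (by exact_mod_cast Finset.card_le_card Finset.sdiff_subset) hE0
    rw [← Finset.sum_sdiff hinert, Finset.sum_eq_zero hnon, add_zero]
    rw [Finset.sum_add_distrib, Finset.sum_add_distrib, ← Finset.mul_sum] at h1
    linarith
  have hfac : Y * ∑ p ∈ inertPrimes D Y, Real.log p / p - Real.log 4 * Y
      ≤ ∑ p ∈ inertPrimes D Y, (Y.factorial.factorization p : ℝ) * Real.log p := by
    have h1 : ∑ p ∈ inertPrimes D Y, ((Y : ℝ) / p - 1) * Real.log p
        ≤ ∑ p ∈ inertPrimes D Y, (Y.factorial.factorization p : ℝ) * Real.log p :=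
      Finset.sum_le_sum fun p hp => mul_le_mul_of_nonneg_right
        (div_sub_one_le_factorization_factorial (mem_inertPrimes.1 hp).1.2 Y)
        (Real.log_natCast_nonneg p)
    have h2 : ∑ p ∈ inertPrimes D Y, ((Y : ℝ) / p - 1) * Real.log p
        = Y * ∑ p ∈ inertPrimes D Y, Real.log p / p - ∑ p ∈ inertPrimes D Y, Real.log p := by
      rw [Finset.mul_sum, ← Finset.sum_sub_distrib]
      refine Finset.sum_congr rfl fun p _ => ?_
      ring
    have h3 := (Finset.sum_le_sum_of_subset_of_nonneg (inertPrimes_subset_primesLE D Y)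
      fun p _ _ => Real.log_natCast_nonneg p).trans (sum_log_primesLE_le Y)
    linarith
  have hcard : ((Nat.primesLE Z).card : ℝ) * E ≤ 35 * Z := by
    have h1 := primesLE_card_mul_log_le (hY.trans hYZ)
    have h2 := mul_le_mul_of_nonneg_left hElog
      (Nat.cast_nonneg (Nat.primesLE Z).card : (0 : ℝ) ≤ _)
    linarith
  have h4 := log_four_le
  have hZc : (Z : ℝ) = L * Y := by rw [hZ]; push_cast; rfl
  have hL1 : (1 : ℝ) ≤ L := by exact_mod_cast hL
  have hfin : (Y : ℝ) * ∑ p ∈ inertPrimes D Y, Real.log p / p ≤ Y * (23 * L) := by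
    rw [hZc] at hcard
    have : (Y : ℝ) * Real.log 4 ≤ Y * 1.4 := mul_le_mul_of_nonneg_left h4 (by linarith)
    nlinarith
  exact le_of_mul_le_mul_left hfin (by linarith)

/-- On every long interval, some value `(2j + e)² - D` has a prime factor far larger than the
endpoints of the interval. -/
theorem exists_large_prime_factor {D : ℤ} (hD : ¬ IsSquare D) {A Y e L : ℕ}
    (hYA : Y ≤ A) (he : e ≤ 1) (hL : 1 ≤ L) (hAL : A + Y ≤ L * Y) (hDL : |D| ≤ L)
    (hY : (2 ^ (120 * L)) ^ 2 ≤ Y) :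
    ∃ j ∈ Finset.Ico A (A + Y), ∃ p : ℕ, p.Prime ∧
      (p : ℤ) ∣ (2 * j + e : ℤ) ^ 2 - D ∧ L * Y < p := by
  by_contra! hcon
  have hpow : 2 * L ≤ 2 ^ (120 * L) := by
    have h1 : 120 * L < 2 ^ (120 * L) := Nat.lt_two_pow_self
    omega
  have hself : 2 ^ (120 * L) ≤ (2 ^ (120 * L)) ^ 2 := Nat.le_self_pow two_ne_zero _
  have h1 := sum_inertPrimes_le_of_smooth hD (by omega) hYA he hL hAL hDL (by omega) hcon
  have hX1 : 1 ≤ 2 ^ (120 * L) := Nat.one_le_two_pow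
  have h2 := log_le_sum_inertPrimes_sq hD hX1
  have h3 := sum_inertPrimes_mono D hY
  have h4 : |(D : ℝ)| ≤ L := by exact_mod_cast hDL
  have hL1 : (1 : ℝ) ≤ L := by exact_mod_cast hL
  rw [Nat.cast_pow, Real.log_pow] at h2
  push_cast at h2
  have h5 := Real.log_two_gt_d9
  nlinarith

/-! ### Linear and quadratic factors -/

/-- A monic integer polynomial of degree one or two, labelled by a class `m`: for `m = 0` it is
`X + b` (and `c` plays no role), for `m ≠ 0` it is `X² + b X + c`. In the latter case the
discriminant is meant to be `m² D` for a fixed `D`, see `ShiftFactor.HasDisc`, so that factors of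
equal class are integer translates of each other. -/
structure ShiftFactor where
  m : ℕ
  b : ℤ
  c : ℤ

namespace ShiftFactor

/-- The value of the factor at an integer. -/
def val (φ : ShiftFactor) (k : ℤ) : ℤ :=
  if φ.m = 0 then k + φ.b else k ^ 2 + φ.b * k + φ.c

/-- The degree of the factor. -/
def deg (φ : ShiftFactor) : ℕ := if φ.m = 0 then 1 else 2

/-- A quadratic factor of class `m` has discriminant `m² D`. -/
def HasDisc (D : ℤ) (φ : ShiftFactor) : Prop :=
  φ.m ≠ 0 → φ.b ^ 2 - 4 * φ.c = (φ.m : ℤ) ^ 2 * D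

/-- All relevant data of the factor are at most `M` in absolute value. -/
def BoundedBy (M : ℕ) (φ : ShiftFactor) : Prop := φ.m ≤ M ∧ |φ.b| ≤ M ∧ (φ.m ≠ 0 → |φ.c| ≤ M)

/-- The product of the first `n` values of the factor. -/
def prodVal (φ : ShiftFactor) (n : ℕ) : ℤ := ∏ k ∈ Finset.Icc 1 n, φ.val k

theorem val_zero_class {φ : ShiftFactor} (h : φ.m = 0) (k : ℤ) : φ.val k = k + φ.b := if_pos h

theorem val_pos_class {φ : ShiftFactor} (h : φ.m ≠ 0) (k : ℤ) :
    φ.val k = k ^ 2 + φ.b * k + φ.c := if_neg h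

theorem val_modEq (φ : ShiftFactor) {n x y : ℤ} (h : x ≡ y [ZMOD n]) :
    φ.val x ≡ φ.val y [ZMOD n] := by
  unfold val
  split_ifs
  · exact h.add_right _
  · exact ((h.pow 2).add (h.mul_left _)).add_right _

theorem abs_val_le {φ : ShiftFactor} {M : ℕ} (h : φ.BoundedBy M) (k : ℤ) :
    |φ.val k| ≤ |k| ^ 2 + M * |k| + |k| + M := by
  obtain ⟨-, hb, hc⟩ := h
  unfold val
  have hk := abs_nonneg k
  split_ifs with h0
  · refine (abs_add_le _ _).trans ?_
    nlinarith [(Nat.cast_nonneg M : (0 : ℤ) ≤ M)]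
  · have hc := hc h0
    refine (abs_add_three _ _ _).trans ?_
    rw [abs_mul, abs_pow]
    nlinarith [mul_le_mul_of_nonneg_right hb hk]

/-- The prime `p` divides a value of the quadratic factor of class `m` only at the zero
`2 k + b = m r` of its reduction modulo `p`, where `r` is a square root of `D`; the size of `p`
turns the congruence into an equality and excludes the conjugate zero. -/
theorem factorization_val {D : ℤ} {φ : ShiftFactor} {M n r p k : ℕ} (hφ : φ.HasDisc D)
    (hM : φ.BoundedBy M) (hp : p.Prime) (hr : (p : ℤ) ∣ (r : ℤ) ^ 2 - D) (hrM : M < r)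
    (hpn : 2 * n + M + M * r < p) (hk : k ∈ Finset.Icc 1 n) (h0 : φ.val k ≠ 0) :
    (φ.val k).natAbs.factorization p =
      if φ.m ≠ 0 ∧ 2 * (k : ℤ) + φ.b = φ.m * r then 1 else 0 := by
  rw [Finset.mem_Icc] at hk
  obtain ⟨hm, hb, hc⟩ := hM
  rw [abs_le] at hb
  have hpZ : Prime (p : ℤ) := Nat.prime_iff_prime_int.1 hp
  have hpn' : (2 * n + M + M * r : ℤ) < p := by exact_mod_cast hpn
  have hk1 : (1 : ℤ) ≤ k := by exact_mod_cast hk.1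
  have hkn : (k : ℤ) ≤ n := by exact_mod_cast hk.2
  have hr' : (M : ℤ) < r := by exact_mod_cast hrM
  have hM0 : (0 : ℤ) ≤ M := Nat.cast_nonneg M
  have hMr : (0 : ℤ) ≤ M * r := by positivity
  by_cases hm0 : φ.m = 0
  · rw [if_neg (fun h => h.1 hm0)]
    refine Nat.factorization_eq_zero_of_not_dvd fun h => h0 ?_
    rw [← Int.natCast_dvd] at h
    refine Int.eq_zero_of_abs_lt_dvd h ?_
    rw [val_zero_class hm0, abs_lt]
    constructor <;> linarith
  · have hc := abs_le.1 (hc hm0)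
    have hm1 : (1 : ℤ) ≤ φ.m := by exact_mod_cast Nat.one_le_iff_ne_zero.2 hm0
    have hmM : (φ.m : ℤ) ≤ M := by exact_mod_cast hm
    have hmr : (φ.m : ℤ) * r ≤ M * r := mul_le_mul_of_nonneg_right hmM (by linarith)
    have hmr' : (r : ℤ) ≤ φ.m * r := by nlinarith
    have hfac : 4 * φ.val k = (2 * k + φ.b - φ.m * r) * (2 * k + φ.b + φ.m * r)
        + (φ.m : ℤ) ^ 2 * ((r : ℤ) ^ 2 - D) := by
      rw [val_pos_class hm0]
      linear_combination (-1 : ℤ) * hφ hm0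
    split_ifs with h
    · have hsmall : ¬ p ^ 2 ∣ (φ.val k).natAbs := by
        intro h2
        apply h0
        rw [← Int.natCast_dvd] at h2
        refine Int.eq_zero_of_abs_lt_dvd h2 ?_
        rw [val_pos_class hm0, abs_lt]
        push_cast
        constructor <;> nlinarith
      have hdvd : (p : ℤ) ∣ φ.val k := by
        have h4 : (p : ℤ) ∣ 4 * φ.val k := by
          rw [hfac, h.2, sub_self, zero_mul, zero_add]
          exact hr.mul_left _
        refine (hpZ.dvd_or_dvd h4).resolve_left fun h5 => ?_
        have := Int.le_of_dvd (by norm_num) h5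
        have : (p : ℤ) ∣ 2 ^ 2 := by simpa using h5
        have := Int.le_of_dvd (by norm_num) (hpZ.dvd_of_dvd_pow this)
        linarith
      have hne := Int.natAbs_ne_zero.2 h0
      have h1 : 1 ≤ (φ.val k).natAbs.factorization p := by
        rw [← hp.pow_dvd_iff_le_factorization hne, pow_one]
        exact Int.natCast_dvd.1 hdvd
      have h2 : ¬ 2 ≤ (φ.val k).natAbs.factorization p := by
        rwa [← hp.pow_dvd_iff_le_factorization hne]
      omega
    · refine Nat.factorization_eq_zero_of_not_dvd fun h1 => h ⟨hm0, ?_⟩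
      rw [← Int.natCast_dvd] at h1
      have h2 : (p : ℤ) ∣ (2 * k + φ.b - φ.m * r) * (2 * k + φ.b + φ.m * r) := by
        have h3 := dvd_sub (h1.mul_left 4) (hr.mul_left ((φ.m : ℤ) ^ 2))
        rwa [hfac, add_sub_cancel_right] at h3
      rcases hpZ.dvd_or_dvd h2 with h3 | h3
      · have := Int.eq_zero_of_abs_lt_dvd h3 (by rw [abs_lt]; constructor <;> linarith)
        linarith
      · have := Int.eq_zero_of_abs_lt_dvd h3 (by rw [abs_lt]; constructor <;> linarith)
        linarith

/-- With `r` between the thresholds of the classes `m₁` and `m₁ + 1`, the prime `p` occurs exactly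
once in the product of the first `n` values of a quadratic factor of class at most `m₁`, and not at
all for the other factors. -/
theorem factorization_prodVal {D : ℤ} {φ : ShiftFactor} {M n r p m₁ : ℕ} (hφ : φ.HasDisc D)
    (hM : φ.BoundedBy M) (hp : p.Prime) (hr : (p : ℤ) ∣ (r : ℤ) ^ 2 - D)
    (hrD : (2 : ℤ) ∣ r - D) (hrM : M + 2 ≤ r) (hpn : 2 * n + M + M * r < p)
    (h0 : φ.prodVal n ≠ 0) (hlow : m₁ * r + M ≤ 2 * n) (hhigh : 2 * n + M < (m₁ + 1) * r) :
    (φ.prodVal n).natAbs.factorization p = if 1 ≤ φ.m ∧ φ.m ≤ m₁ then 1 else 0 := by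
  have h0' : ∀ k ∈ Finset.Icc 1 n, φ.val k ≠ 0 := Finset.prod_ne_zero_iff.1 h0
  have h1 : (φ.prodVal n).natAbs = ∏ k ∈ Finset.Icc 1 n, (φ.val k).natAbs :=
    map_prod Int.natAbsHom _ _
  rw [h1, Nat.factorization_prod_apply fun k hk => Int.natAbs_ne_zero.2 (h0' k hk),
    Finset.sum_congr rfl fun k hk =>
      factorization_val hφ hM hp hr (by omega) hpn hk (h0' k hk)]
  by_cases hm0 : φ.m = 0
  · simp [hm0]
  have hm1 : 1 ≤ φ.m := Nat.one_le_iff_ne_zero.2 hm0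
  obtain ⟨-, hb, -⟩ := hM
  rw [abs_le] at hb
  -- the parity of `b` is that of `m * D`, hence of `m * r`
  obtain ⟨k₀, hk₀⟩ : ∃ k₀ : ℤ, 2 * k₀ + φ.b = φ.m * r := by
    obtain ⟨t, ht⟩ := hrD
    have hdisc := hφ hm0
    have h2 : (2 : ℤ) ∣ φ.m * r - φ.b := by
      have h3 : Even ((φ.m : ℤ) * r - φ.b) := by
        have h4 : (φ.b ^ 2 - 4 * φ.c) % 2 = ((φ.m : ℤ) ^ 2 * D) % 2 := by rw [hdisc]
        have h5 : (r : ℤ) = D + 2 * t := by linarith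
        have h6 : Even (φ.b ^ 2 - (φ.m : ℤ) ^ 2 * D) :=
          ⟨2 * φ.c, by linarith⟩
        rw [h5]
        rw [Int.even_sub, Int.even_pow' two_ne_zero, Int.even_mul, Int.even_pow' two_ne_zero] at h6
        rw [Int.even_sub, Int.even_mul, Int.even_add]
        have h7 : Even (2 * t) := even_two_mul t
        tauto
      exact h3.two_dvd
    obtain ⟨k₀, hk⟩ := h2
    exact ⟨k₀, by linarith⟩
  have h2 : ∀ k : ℕ, (φ.m ≠ 0 ∧ 2 * (k : ℤ) + φ.b = φ.m * r) ↔ (k : ℤ) = k₀ := by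
    intro k
    constructor
    · rintro ⟨-, h⟩
      linarith
    · rintro h
      exact ⟨hm0, by rw [h, hk₀]⟩
  simp only [h2]
  have hr' : (M : ℤ) + 2 ≤ r := by exact_mod_cast hrM
  have hmr : (r : ℤ) ≤ φ.m * r := by
    have : (1 : ℤ) ≤ φ.m := by exact_mod_cast hm1
    nlinarith
  have hk₀pos : 1 ≤ k₀ := by linarith
  lift k₀ to ℕ using by linarith
  simp only [Nat.cast_inj]
  rw [Finset.sum_ite_eq']
  refine if_congr ?_ rfl rfl
  rw [Finset.mem_Icc]
  constructor
  · rintro ⟨-, h3⟩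
    refine ⟨hm1, ?_⟩
    by_contra h4
    have h5 : (m₁ + 1) * r ≤ φ.m * r := Nat.mul_le_mul_right _ (by omega)
    have h6 : (((m₁ + 1) * r : ℕ) : ℤ) ≤ φ.m * r := by exact_mod_cast h5
    have h7 : ((2 * n + M : ℕ) : ℤ) < ((m₁ + 1) * r : ℕ) := by exact_mod_cast hhigh
    have h8 : (k₀ : ℤ) ≤ n := by exact_mod_cast h3
    push_cast at h6 h7
    linarith
  · rintro ⟨-, h3⟩
    refine ⟨by exact_mod_cast hk₀pos, ?_⟩
    have h5 : φ.m * r ≤ m₁ * r := Nat.mul_le_mul_right _ h3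
    have h6 : ((φ.m * r + M : ℕ) : ℤ) ≤ (2 * n : ℕ) := by exact_mod_cast (by omega)
    push_cast at h6
    have : (k₀ : ℤ) ≤ n := by linarith
    exact_mod_cast this

theorem factorization_prod_prodVal {D : ℤ} {M n r p m₁ : ℕ} (hp : p.Prime)
    (hr : (p : ℤ) ∣ (r : ℤ) ^ 2 - D) (hrD : (2 : ℤ) ∣ r - D) (hrM : M + 2 ≤ r)
    (hpn : 2 * n + M + M * r < p) (hlow : m₁ * r + M ≤ 2 * n)
    (hhigh : 2 * n + M < (m₁ + 1) * r) (L : Multiset ShiftFactor)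
    (hL : ∀ φ ∈ L, φ.HasDisc D ∧ φ.BoundedBy M) (h0 : (L.map (prodVal · n)).prod ≠ 0) :
    (L.map (prodVal · n)).prod.natAbs.factorization p =
      L.countP fun φ => 1 ≤ φ.m ∧ φ.m ≤ m₁ := by
  induction L using Multiset.induction_on with
  | empty => simp
  | cons φ L ih =>
    rw [Multiset.map_cons, Multiset.prod_cons] at h0 ⊢
    have h1 := left_ne_zero_of_mul h0
    have h2 := right_ne_zero_of_mul h0
    rw [Int.natAbs_mul, Nat.factorization_mul (Int.natAbs_ne_zero.2 h1) (Int.natAbs_ne_zero.2 h2),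
      Finsupp.add_apply, ih (fun ψ hψ => hL ψ (Multiset.mem_cons_of_mem hψ)) h2,
      factorization_prodVal (hL φ (Multiset.mem_cons_self φ L)).1
        (hL φ (Multiset.mem_cons_self φ L)).2 hp hr hrD hrM hpn h1 hlow hhigh,
      Multiset.countP_cons, add_comm]

end ShiftFactor

/-- From this index on, every class of quadratic factors is detected by a prime. -/
def separationBound (M : ℕ) : ℕ := (M + 1) * (M * ((2 ^ (120 * (20 * M ^ 3))) ^ 2 + 2 * M))

theorem exists_separating_prime {D : ℤ} (hD : ¬ IsSquare D) {M n m₁ : ℕ} (hDM : |D| ≤ M)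
    (hm₁ : 1 ≤ m₁) (hm₁M : m₁ ≤ M) (hn : separationBound M ≤ n) :
    ∃ r p : ℕ, p.Prime ∧ (p : ℤ) ∣ (r : ℤ) ^ 2 - D ∧ (2 : ℤ) ∣ r - D ∧ M + 2 ≤ r ∧
      2 * n + M + M * r < p ∧ m₁ * r + M ≤ 2 * n ∧ 2 * n + M < (m₁ + 1) * r := by
  set L := 20 * M ^ 3 with hL
  set P := (2 ^ (120 * L)) ^ 2 with hP
  have hM : 1 ≤ M := hm₁.trans hm₁M
  have hM3 : M ≤ M ^ 3 := Nat.le_self_pow (by norm_num) M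
  have hPM : 2 * M + 2 ≤ P := by
    have h1 : 120 * L < 2 ^ (120 * L) := Nat.lt_two_pow_self
    have h2 : 2 ^ (120 * L) ≤ P := Nat.le_self_pow two_ne_zero _
    omega
  set q := n / (m₁ + 1) with hq
  set w := q / m₁ with hw
  have hqn : (m₁ + 1) * q ≤ n := Nat.mul_div_le n (m₁ + 1)
  have hnq : n < (m₁ + 1) * (q + 1) := Nat.lt_mul_div_succ n (by omega)
  have hwq : m₁ * w ≤ q := Nat.mul_div_le q m₁
  have hqw : q < m₁ * (w + 1) := Nat.lt_mul_div_succ q hm₁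
  have hwP : P + 2 * M ≤ w := by
    rw [hw, Nat.le_div_iff_mul_le hm₁, hq, Nat.le_div_iff_mul_le (by omega)]
    refine le_trans ?_ hn
    rw [separationBound, ← hL, ← hP, mul_comm (P + 2 * M), mul_comm _ (m₁ + 1)]
    exact Nat.mul_le_mul (by omega) (Nat.mul_le_mul_right _ hm₁M)
  obtain ⟨Y, hY⟩ : ∃ Y, w = Y + 2 * M := ⟨w - 2 * M, by omega⟩
  have hYP : P ≤ Y := by omega
  have hq1 : q + 1 ≤ 2 * M * Y := by
    calc q + 1 ≤ m₁ * (w + 1) := hqw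
      _ ≤ M * (2 * Y) := Nat.mul_le_mul hm₁M (by omega)
      _ = 2 * M * Y := by ring
  have hMY : Y ≤ M ^ 3 * Y := Nat.le_mul_of_pos_left Y (by positivity)
  have hM2 : M * Y ≤ M ^ 3 * Y := Nat.mul_le_mul_right Y hM3
  have hL20 : L * Y = 20 * (M ^ 3 * Y) := by rw [hL]; ring
  have hqY : Y ≤ q := by nlinarith
  set e := (D % 2).toNat with he
  have hmod := Int.emod_two_eq_zero_or_one D
  have he' : (e : ℤ) = D % 2 := Int.toNat_of_nonneg (by omega)
  obtain ⟨j, hj, p, hp, hpd, hpL⟩ := exists_large_prime_factor hD (A := q + M) (Y := Y) (e := e)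
    (L := L) (by omega) (by omega) (by rw [hL]; omega)
    (by
      have : 2 * M * Y = 2 * (M * Y) := by ring
      have : M ≤ Y := by omega
      omega)
    (by
      refine hDM.trans ?_
      exact_mod_cast (by omega : M ≤ L)) hYP
  rw [Finset.mem_Ico] at hj
  have hrlow : m₁ * (2 * j + e) + M ≤ 2 * n := by
    have h1 : 2 * j + e ≤ 2 * (q + M + Y) := by omega
    have h2 := Nat.mul_le_mul_left m₁ h1
    rw [hY] at hwq
    have h3 : M ≤ m₁ * M := Nat.le_mul_of_pos_left M hm₁
    nlinarith
  refine ⟨2 * j + e, p, hp, ?_, ?_, by omega, ?_, hrlow, ?_⟩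
  · push_cast
    exact hpd
  · push_cast
    omega
  · have h1 : 2 * j + e ≤ 2 * n :=
      (Nat.le_mul_of_pos_left (2 * j + e) hm₁).trans (by omega)
    have h2 : n ≤ 4 * (M ^ 2 * Y) := by
      have : (m₁ + 1) * (q + 1) ≤ (2 * M) * (2 * M * Y) := Nat.mul_le_mul (by omega) hq1
      nlinarith
    have h3 : M * (2 * j + e) ≤ M * (2 * n) := Nat.mul_le_mul_left M h1
    have h4 : M * n ≤ M * (4 * (M ^ 2 * Y)) := Nat.mul_le_mul_left M h2
    have h5 : M * (4 * (M ^ 2 * Y)) = 4 * (M ^ 3 * Y) := by ring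
    have h6 : n ≤ M * n := Nat.le_mul_of_pos_left n hM
    have h7 : M ≤ Y := by omega
    have h8 : M * (2 * n) = 2 * (M * n) := by ring
    omega
  · have h1 : 2 * (q + M) ≤ 2 * j + e := by omega
    have h2 := Nat.mul_le_mul_left (m₁ + 1) h1
    nlinarith

namespace ShiftFactor

theorem countP_class_le_succ (L : Multiset ShiftFactor) (i : ℕ) :
    L.countP (fun φ => 1 ≤ φ.m ∧ φ.m ≤ i + 1)
      = L.countP (fun φ => 1 ≤ φ.m ∧ φ.m ≤ i) + (L.map m).count (i + 1) := by
  induction L using Multiset.induction_on with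
  | empty => simp
  | cons φ L ih =>
    rw [Multiset.countP_cons, Multiset.countP_cons, Multiset.map_cons, Multiset.count_cons, ih]
    split_ifs <;> omega

theorem sum_deg_eq {M : ℕ} (L : Multiset ShiftFactor) (hL : ∀ φ ∈ L, φ.BoundedBy M) :
    (L.map deg).sum = (L.map m).count 0 + 2 * L.countP (fun φ => 1 ≤ φ.m ∧ φ.m ≤ M) := by
  induction L using Multiset.induction_on with
  | empty => simp
  | cons φ L ih =>
    rw [Multiset.countP_cons, Multiset.map_cons, Multiset.map_cons, Multiset.sum_cons,
      Multiset.count_cons, ih fun ψ hψ => hL ψ (Multiset.mem_cons_of_mem hψ), deg]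
    have h := (hL φ (Multiset.mem_cons_self φ L)).1
    split_ifs <;> omega

/-- If `∏ F(k)` and `∏ G(k)` agree up to small constants, then each separating prime counts the
quadratic factors up to a given class, so `F` and `G` have the same classes. -/
theorem map_m_eq {D : ℤ} {M n : ℕ} {c c' : ℤ} {F G : Multiset ShiftFactor}
    (hDM : (∃ φ ∈ F + G, φ.m ≠ 0) → ¬ IsSquare D ∧ |D| ≤ M)
    (hF : ∀ φ ∈ F, φ.HasDisc D ∧ φ.BoundedBy M) (hG : ∀ φ ∈ G, φ.HasDisc D ∧ φ.BoundedBy M)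
    (hdeg : (F.map deg).sum = (G.map deg).sum) (hn : separationBound M ≤ n)
    (hc : |c| ≤ M) (hc' : |c'| ≤ M)
    (heq : c * (G.map (prodVal · n)).prod = c' * (F.map (prodVal · n)).prod)
    (h0 : c' * (F.map (prodVal · n)).prod ≠ 0) :
    F.map m = G.map m := by
  have hcount : ∀ i ≤ M, F.countP (fun φ => 1 ≤ φ.m ∧ φ.m ≤ i)
      = G.countP (fun φ => 1 ≤ φ.m ∧ φ.m ≤ i) := by
    intro i hi
    by_cases hex : ∃ φ ∈ F + G, φ.m ≠ 0
    · rcases Nat.eq_zero_or_pos i with rfl | hi0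
      · rw [Multiset.countP_eq_zero.2 (fun φ _ h => by omega),
          Multiset.countP_eq_zero.2 (fun φ _ h => by omega)]
      obtain ⟨hD, hDM⟩ := hDM hex
      obtain ⟨r, p, hp, hr, hrD, hrM, hpn, hlow, hhigh⟩ :=
        exists_separating_prime hD hDM hi0 hi hn
      have hG0 : c * (G.map (prodVal · n)).prod ≠ 0 := heq ▸ h0
      have hunit : ∀ x : ℤ, |x| ≤ M → x ≠ 0 → x.natAbs.factorization p = 0 := by
        intro x hx hx0
        refine Nat.factorization_eq_zero_of_not_dvd fun h => hx0 ?_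
        refine Int.eq_zero_of_abs_lt_dvd (Int.natCast_dvd.2 h) (hx.trans_lt ?_)
        exact_mod_cast (by omega : M < p)
      have h1 := congrArg (fun x : ℤ => x.natAbs.factorization p) heq
      simp only [Int.natAbs_mul] at h1
      rw [Nat.factorization_mul (Int.natAbs_ne_zero.2 (left_ne_zero_of_mul hG0))
          (Int.natAbs_ne_zero.2 (right_ne_zero_of_mul hG0)),
        Nat.factorization_mul (Int.natAbs_ne_zero.2 (left_ne_zero_of_mul h0))
          (Int.natAbs_ne_zero.2 (right_ne_zero_of_mul h0)), Finsupp.add_apply, Finsupp.add_apply,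
        hunit c hc (left_ne_zero_of_mul hG0), hunit c' hc' (left_ne_zero_of_mul h0),
        factorization_prod_prodVal hp hr hrD hrM hpn hlow hhigh G hG (right_ne_zero_of_mul hG0),
        factorization_prod_prodVal hp hr hrD hrM hpn hlow hhigh F hF (right_ne_zero_of_mul h0)]
        at h1
      omega
    · push Not at hex
      rw [Multiset.countP_eq_zero.2 (fun φ hφ h => by
          have := hex φ (Multiset.mem_add.2 (Or.inl hφ)); omega),
        Multiset.countP_eq_zero.2 (fun φ hφ h => by
          have := hex φ (Multiset.mem_add.2 (Or.inr hφ)); omega)]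
  ext i
  rcases i with _ | i
  · rw [sum_deg_eq F fun φ hφ => (hF φ hφ).2, sum_deg_eq G fun φ hφ => (hG φ hφ).2,
      hcount M le_rfl] at hdeg
    omega
  · by_cases hi : i + 1 ≤ M
    · have h1 := hcount (i + 1) hi
      rw [countP_class_le_succ, countP_class_le_succ, hcount i (by omega)] at h1
      omega
    · have hz : ∀ L : Multiset ShiftFactor, (∀ φ ∈ L, φ.HasDisc D ∧ φ.BoundedBy M) →
          (L.map m).count (i + 1) = 0 := by
        intro L hL
        rw [Multiset.count_eq_zero, Multiset.mem_map]
        rintro ⟨φ, hφ, hm⟩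
        have := (hL φ hφ).2.1
        omega
      rw [hz F hF, hz G hG]

/-! ### Telescoping products of translates -/

/-- `u` and `v` agree up to cofactors congruent modulo `n` to one and the same nonzero integer of
absolute value at most `E`. -/
def AgreeUpTo (n : ℤ) (E : ℤ) (u v : ℤ) : Prop :=
  ∃ P Q R : ℤ, u * Q = v * P ∧ P ≡ R [ZMOD n] ∧ Q ≡ R [ZMOD n] ∧ R ≠ 0 ∧ |R| ≤ E

theorem AgreeUpTo.symm {n E u v : ℤ} (h : AgreeUpTo n E u v) : AgreeUpTo n E v u := by
  obtain ⟨P, Q, R, h1, h2, h3, h4⟩ := h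
  exact ⟨Q, P, R, h1.symm, h3, h2, h4⟩

theorem AgreeUpTo.mul {n E E' u v u' v' : ℤ} (h : AgreeUpTo n E u v) (h' : AgreeUpTo n E' u' v') :
    AgreeUpTo n (E * E') (u * u') (v * v') := by
  obtain ⟨P, Q, R, h1, h2, h3, h4, h5⟩ := h
  obtain ⟨P', Q', R', h1', h2', h3', h4', h5'⟩ := h'
  refine ⟨P * P', Q * Q', R * R', ?_, h2.mul h2', h3.mul h3', mul_ne_zero h4 h4', ?_⟩
  · linear_combination h1 * (u' * Q') + v * P * h1'
  · rw [abs_mul]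
    exact mul_le_mul h5 h5' (abs_nonneg _) ((abs_nonneg _).trans h5)

theorem exists_shift {D : ℤ} {M : ℕ} {φ ψ : ShiftFactor} (hm : φ.m = ψ.m) (hφ : φ.HasDisc D)
    (hψ : ψ.HasDisc D) (hφM : φ.BoundedBy M) (hψM : ψ.BoundedBy M) :
    ∃ s : ℤ, |s| ≤ 2 * M ∧ ∀ k, ψ.val k = φ.val (k - s) := by
  have hb := hφM.2.1
  have hb' := hψM.2.1
  rw [abs_le] at hb hb'
  by_cases h0 : φ.m = 0
  · refine ⟨φ.b - ψ.b, ?_, fun k => ?_⟩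
    · rw [abs_le]
      constructor <;> linarith
    · rw [val_zero_class h0, val_zero_class (hm ▸ h0)]
      ring
  · have h1 := hφ h0
    have h2 := hψ (hm ▸ h0)
    rw [← hm] at h2
    have hpar : Even (φ.b - ψ.b) := by
      have h3 : Even (φ.b ^ 2 - ψ.b ^ 2) := ⟨2 * (φ.c - ψ.c), by linarith⟩
      rw [Int.even_sub, Int.even_pow' two_ne_zero, Int.even_pow' two_ne_zero] at h3
      rwa [Int.even_sub]
    obtain ⟨s, hs⟩ := hpar
    refine ⟨s, ?_, fun k => ?_⟩
    · rw [abs_le]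
      constructor <;> linarith
    · rw [val_pos_class h0, val_pos_class (hm ▸ h0)]
      have hb2 : ψ.b = φ.b - 2 * s := by linarith
      have hc4 : 4 * ψ.c = 4 * (s ^ 2 - φ.b * s + φ.c) := by
        rw [hb2] at h2
        linear_combination h1 - h2
      have hc2 : ψ.c = s ^ 2 - φ.b * s + φ.c := by linarith
      rw [hb2, hc2]
      ring

theorem prod_shift_mul (h : ℤ → ℤ) (n s : ℕ) :
    (∏ k ∈ Finset.Icc 1 n, h (k - s)) * ∏ l ∈ Finset.range s, h (n - l)
      = (∏ k ∈ Finset.Icc 1 n, h k) * ∏ l ∈ Finset.range s, h (-l) := by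
  have step : ∀ g : ℤ → ℤ, (∏ k ∈ Finset.Icc 1 n, g (k - 1)) * g n
      = (∏ k ∈ Finset.Icc 1 n, g k) * g 0 := by
    intro g
    induction n with
    | zero => simp
    | succ n ih =>
      rw [Finset.prod_Icc_succ_top (by omega), Finset.prod_Icc_succ_top (by omega)]
      push_cast
      rw [add_sub_cancel_right, ih]
      ring
  induction s with
  | zero => simp
  | succ s ih =>
    rw [Finset.prod_range_succ, Finset.prod_range_succ]
    have h1 := step fun x => h (x - s)
    have h2 : ∀ k : ℕ, h ((k : ℤ) - 1 - s) = h (k - (s + 1 : ℕ)) := by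
      intro k
      congr 1
      push_cast
      ring
    simp only [h2, zero_sub] at h1
    linear_combination (∏ l ∈ Finset.range s, h (n - l)) * h1 + h (-s) * ih

/-- A bound for the end factors left over when the product of a factor is divided by the product
of a translate of it. -/
def shiftBound (M : ℕ) : ℕ := (14 * (M + 1) ^ 2) ^ (2 * M)

theorem agreeUpTo_of_shift {M n s : ℕ} {φ ψ : ShiftFactor} (hs : s ≤ 2 * M) (hsn : s ≤ n)
    (hφ : φ.BoundedBy M) (h : ∀ k, ψ.val k = φ.val (k - s)) (h0 : ψ.prodVal n ≠ 0) :
    AgreeUpTo n (shiftBound M) (ψ.prodVal n) (φ.prodVal n) := by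
  refine ⟨∏ l ∈ Finset.range s, φ.val (-l), ∏ l ∈ Finset.range s, φ.val (n - l),
    ∏ l ∈ Finset.range s, φ.val (-l), ?_, rfl, ?_, ?_, ?_⟩
  · simp only [prodVal, h]
    exact prod_shift_mul φ.val n s
  · refine Int.ModEq.prod fun l _ => φ.val_modEq ?_
    exact Int.modEq_iff_dvd.2 ⟨-1, by ring⟩
  · rw [Finset.prod_ne_zero_iff]
    intro l hl
    rw [Finset.mem_range] at hl
    have h1 := Finset.prod_ne_zero_iff.1 h0 (s - l) (Finset.mem_Icc.2 ⟨by omega, by omega⟩)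
    rw [h, Nat.cast_sub hl.le] at h1
    convert h1 using 2
    ring
  · rw [Finset.abs_prod]
    have h1 : ∀ l ∈ Finset.range s, |φ.val (-l)| ≤ 14 * ((M : ℤ) + 1) ^ 2 := by
      intro l hl
      rw [Finset.mem_range] at hl
      refine (abs_val_le hφ _).trans ?_
      rw [abs_neg, Nat.abs_cast]
      have h2 : (l : ℤ) ≤ 2 * M := by exact_mod_cast (by omega : l ≤ 2 * M)
      nlinarith [(Nat.cast_nonneg l : (0 : ℤ) ≤ l)]
    refine (Finset.prod_le_prod (fun _ _ => abs_nonneg _) h1).trans ?_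
    rw [Finset.prod_const, Finset.card_range, shiftBound]
    push_cast
    exact pow_le_pow_right₀ (by nlinarith) hs

theorem agreeUpTo_of_m_eq {D : ℤ} {M n : ℕ} {φ ψ : ShiftFactor} (hn : 2 * M ≤ n)
    (hm : φ.m = ψ.m) (hφ : φ.HasDisc D ∧ φ.BoundedBy M) (hψ : ψ.HasDisc D ∧ ψ.BoundedBy M)
    (hφ0 : φ.prodVal n ≠ 0) (hψ0 : ψ.prodVal n ≠ 0) :
    AgreeUpTo n (shiftBound M) (ψ.prodVal n) (φ.prodVal n) := by
  obtain ⟨s, hs, h⟩ := exists_shift hm hφ.1 hψ.1 hφ.2 hψ.2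
  rw [abs_le] at hs
  rcases le_total 0 s with h0 | h0
  · lift s to ℕ using h0
    exact agreeUpTo_of_shift (by omega) (by omega) hφ.2 h hψ0
  · obtain ⟨t, rfl⟩ : ∃ t : ℕ, s = -t := ⟨(-s).toNat, by omega⟩
    refine (agreeUpTo_of_shift (s := t) (by omega) (by omega) hψ.2 (fun k => ?_) hφ0).symm
    rw [h]
    congr 1
    ring

theorem agreeUpTo_of_map_m_eq {D : ℤ} {M n : ℕ} (hn : 2 * M ≤ n) {F G : Multiset ShiftFactor}
    (hm : F.map m = G.map m) (hF : ∀ φ ∈ F, φ.HasDisc D ∧ φ.BoundedBy M)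
    (hG : ∀ φ ∈ G, φ.HasDisc D ∧ φ.BoundedBy M) (hF0 : (F.map (prodVal · n)).prod ≠ 0)
    (hG0 : (G.map (prodVal · n)).prod ≠ 0) :
    AgreeUpTo n (shiftBound M ^ F.card) (G.map (prodVal · n)).prod (F.map (prodVal · n)).prod := by
  have hrel : Multiset.Rel (fun φ ψ : ShiftFactor => φ.m = ψ.m) F G := by
    rw [← Multiset.rel_eq, Multiset.rel_map] at hm
    exact hm
  clear hm
  induction hrel with
  | zero => exact ⟨1, 1, 1, by simp, rfl, rfl, one_ne_zero, by simp⟩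
  | @cons φ ψ F G hφψ _ ih =>
    rw [Multiset.map_cons, Multiset.prod_cons] at hF0 hG0 ⊢
    rw [Multiset.map_cons, Multiset.prod_cons, Multiset.card_cons, pow_succ']
    exact (agreeUpTo_of_m_eq hn hφψ (hF φ (Multiset.mem_cons_self _ _))
      (hG ψ (Multiset.mem_cons_self _ _)) (left_ne_zero_of_mul hF0)
      (left_ne_zero_of_mul hG0)).mul
      (ih (fun χ h => hF χ (Multiset.mem_cons_of_mem h))
        (fun χ h => hG χ (Multiset.mem_cons_of_mem h)) (right_ne_zero_of_mul hF0)
        (right_ne_zero_of_mul hG0))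

/-- Beyond this index, proportionality of the two products with small constants forces the
constants to be equal. -/
def matchBound (M : ℕ) : ℕ := separationBound M + 2 * M + 2 * M * shiftBound M ^ M

theorem const_eq_of_prod_eq {D : ℤ} {M n : ℕ} {c c' : ℤ} {F G : Multiset ShiftFactor}
    (hDM : (∃ φ ∈ F + G, φ.m ≠ 0) → ¬ IsSquare D ∧ |D| ≤ M)
    (hF : ∀ φ ∈ F, φ.HasDisc D ∧ φ.BoundedBy M) (hG : ∀ φ ∈ G, φ.HasDisc D ∧ φ.BoundedBy M)
    (hFc : F.card ≤ M) (hdeg : (F.map deg).sum = (G.map deg).sum) (hn : matchBound M < n)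
    (hc : |c| ≤ M) (hc' : |c'| ≤ M)
    (heq : c * (G.map (prodVal · n)).prod = c' * (F.map (prodVal · n)).prod)
    (h0 : c' * (F.map (prodVal · n)).prod ≠ 0) : c = c' := by
  have hb : matchBound M = separationBound M + 2 * M + 2 * M * shiftBound M ^ M := rfl
  have hm := map_m_eq hDM hF hG hdeg (by omega) hc hc' heq h0
  have hF0 := right_ne_zero_of_mul h0
  have hG0 : (G.map (prodVal · n)).prod ≠ 0 := right_ne_zero_of_mul (heq ▸ h0)
  obtain ⟨P, Q, R, h1, h2, h3, h4, h5⟩ :=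
    agreeUpTo_of_map_m_eq (by omega) hm hF hG hF0 hG0
  have h6 : c * P = c' * Q := by
    refine mul_left_cancel₀ hF0 ?_
    linear_combination Q * heq - c * h1
  have h7 : (n : ℤ) ∣ (c - c') * R := by
    have h8 : c' * R ≡ c * R [ZMOD n] :=
      ((h3.mul_left c').symm.trans (by rw [h6])).trans (h2.mul_left c)
    rw [sub_mul]
    exact h8.dvd
  have h8 : (c - c') * R = 0 := by
    refine Int.eq_zero_of_abs_lt_dvd h7 ?_
    rw [abs_mul]
    have h9 : |c - c'| ≤ 2 * M := (abs_sub _ _).trans (by linarith)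
    have h10 : |R| ≤ (shiftBound M : ℤ) ^ M := by
      refine h5.trans (pow_le_pow_right₀ ?_ hFc)
      have : 1 ≤ shiftBound M := Nat.one_le_pow _ _ (by positivity)
      exact_mod_cast this
    refine (mul_le_mul h9 h10 (abs_nonneg _) (by positivity)).trans_lt ?_
    exact_mod_cast (by omega : 2 * M * shiftBound M ^ M < n)
  rcases mul_eq_zero.1 h8 with h9 | h9
  · linarith
  · exact absurd h9 h4

end ShiftFactor

/-! ### Factorization over a quadratic field -/

theorem exists_eq_sq_mul_squarefree (d : ℤ) (hd : d ≠ 0) :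
    ∃ (m : ℕ) (D : ℤ), m ≠ 0 ∧ Squarefree D ∧ d = (m : ℤ) ^ 2 * D := by
  obtain ⟨a, b, hab, ha⟩ := Nat.sq_mul_squarefree d.natAbs
  have hb : b ≠ 0 := by
    rintro rfl
    apply hd
    rw [← Int.natAbs_eq_zero, ← hab]
    simp
  have h1 : (b : ℤ) ^ 2 * a = d.natAbs := by exact_mod_cast hab
  rcases Int.natAbs_eq d with h | h
  · exact ⟨b, a, hb, Int.squarefree_natCast.2 ha, by rw [h1]; exact h⟩
  · refine ⟨b, -a, hb, ?_, by rw [mul_neg, h1]; exact h⟩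
    rw [← Int.squarefree_natAbs, Int.natAbs_neg, Int.squarefree_natAbs]
    exact Int.squarefree_natCast.2 ha

theorem eq_of_squarefree_of_isSquare_mul {a b : ℤ} (ha : Squarefree a) (hb : Squarefree b)
    (h : IsSquare (a * b)) : a = b := by
  obtain ⟨z, hz⟩ := h
  have h1 : a ∣ z := by
    rw [← ha.dvd_pow_iff_dvd two_ne_zero, sq, ← hz]
    exact dvd_mul_right a b
  obtain ⟨w, rfl⟩ := h1
  have h2 : b = w * w * a := by
    refine mul_left_cancel₀ ha.ne_zero ?_
    linear_combination hz
  have h3 := hb w (by rw [h2]; exact dvd_mul_right _ _)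
  rw [h2, ← sq, Int.isUnit_sq h3, one_mul]

/-- A quadratic field contains square roots of integers of a single square class other than the
trivial one. -/
theorem exists_squareClass {K : Type*} [Field K] [Algebra ℚ K] (hK : Module.finrank ℚ K = 2) :
    ∃ D : ℤ, ¬ IsSquare D ∧ ∀ d : ℤ, ¬ IsSquare d → (∃ x : K, x ^ 2 = d) →
      ∃ m : ℕ, m ≠ 0 ∧ d = (m : ℤ) ^ 2 * D := by
  by_cases hex : ∃ d : ℤ, ¬ IsSquare d ∧ ∃ x : K, x ^ 2 = d
  · obtain ⟨d₁, hd₁, x, hx⟩ := hex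
    have hne : ∀ d : ℤ, ¬ IsSquare d → d ≠ 0 := by
      rintro d hd rfl
      exact hd IsSquare.zero
    have hnsq : ∀ d : ℤ, ¬ IsSquare d → ∀ {y : K}, y ^ 2 = d → ∀ z : ℚ, y ≠ algebraMap ℚ K z := by
      intro d hd y hy z hz
      apply hd
      rw [← Rat.isSquare_intCast_iff]
      refine ⟨z, ?_⟩
      apply (algebraMap ℚ K).injective
      rw [map_mul, ← hz, ← sq, hy, map_intCast]
    obtain ⟨m₁, D, hm₁, hD, hd₁D⟩ := exists_eq_sq_mul_squarefree d₁ (hne d₁ hd₁)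
    refine ⟨D, ?_, ?_⟩
    · rintro ⟨e, he⟩
      exact hd₁ ⟨m₁ * e, by rw [hd₁D, he]; ring⟩
    · rintro d₂ hd₂ ⟨y, hy⟩
      obtain ⟨m₂, D₂, hm₂, hD₂, hd₂D⟩ := exists_eq_sq_mul_squarefree d₂ (hne d₂ hd₂)
      -- in the basis `1, x` the square of `y` is rational only if `y` is a multiple of `x`
      have hli : LinearIndependent ℚ ![(1 : K), x] := by
        rw [LinearIndependent.pair_iff]
        intro s t hst
        have ht : t = 0 := by
          by_contra ht
          refine hnsq d₁ hd₁ hx (-s / t) ?_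
          have ht' : algebraMap ℚ K t ≠ 0 := (map_ne_zero (algebraMap ℚ K)).2 ht
          rw [map_div₀, eq_div_iff ht', map_neg]
          rw [Algebra.smul_def, Algebra.smul_def, mul_one] at hst
          linear_combination hst
        subst ht
        rw [zero_smul, add_zero, Algebra.smul_def, mul_one] at hst
        exact ⟨(map_eq_zero (algebraMap ℚ K)).1 hst, rfl⟩
      have hspan := hli.span_eq_top_of_card_eq_finrank (by simp [hK])
      have hymem : y ∈ Submodule.span ℚ (Set.range ![(1 : K), x]) := by rw [hspan]; trivial
      rw [Matrix.range_cons, Matrix.range_cons, Matrix.range_empty, Set.union_empty,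
        Set.singleton_union, Submodule.mem_span_pair] at hymem
      obtain ⟨s, t, hst⟩ := hymem
      rw [Algebra.smul_def, Algebra.smul_def, mul_one] at hst
      have h1 : (algebraMap ℚ K) (2 * s * t) * x
          = algebraMap ℚ K (d₂ - s ^ 2 - t ^ 2 * d₁) := by
        simp only [map_sub, map_mul, map_pow, map_intCast, map_ofNat]
        rw [← hst] at hy
        linear_combination hy - (algebraMap ℚ K t) ^ 2 * hx
      have h2 : 2 * s * t = 0 := by
        by_contra h0
        refine hnsq d₁ hd₁ hx ((d₂ - s ^ 2 - t ^ 2 * d₁) / (2 * s * t)) ?_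
        have h0' : algebraMap ℚ K (2 * s * t) ≠ 0 := by
          rw [Ne, map_eq_zero]
          exact h0
        rw [map_div₀, eq_div_iff h0', mul_comm]
        exact h1
      have ht : t ≠ 0 := by
        rintro rfl
        refine hnsq d₂ hd₂ hy s ?_
        rw [← hst, map_zero, zero_mul, add_zero]
      have hs : s = 0 := by
        rcases mul_eq_zero.1 h2 with h | h
        · simpa using h
        · exact absurd h ht
      subst hs
      have h3 : (d₂ : ℚ) = t ^ 2 * d₁ := by
        rw [mul_zero, zero_mul, map_zero, zero_mul] at h1
        have := (map_eq_zero (algebraMap ℚ K)).1 h1.symm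
        linarith
      have h4 : IsSquare (D * D₂) := by
        rw [← Rat.isSquare_intCast_iff]
        refine ⟨t * D * m₁ / m₂, ?_⟩
        have hm₂' : (m₂ : ℚ) ≠ 0 := by exact_mod_cast hm₂
        have h5 : (d₁ : ℚ) = m₁ ^ 2 * D := by exact_mod_cast hd₁D
        have h6 : (d₂ : ℚ) = m₂ ^ 2 * D₂ := by exact_mod_cast hd₂D
        rw [h5, h6] at h3
        push_cast
        field_simp
        linear_combination (D : ℚ) * h3
      rw [eq_of_squarefree_of_isSquare_mul hD hD₂ h4]
      exact ⟨m₂, hm₂, hd₂D⟩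
  · push Not at hex
    refine ⟨2, ?_, fun d hd ⟨x, hx⟩ => absurd hx (hex d hd x)⟩
    exact Int.prime_two.irreducible.not_isSquare

namespace ShiftFactor

/-- The factor as a polynomial. -/
noncomputable def poly (φ : ShiftFactor) : ℤ[X] :=
  if φ.m = 0 then X + C φ.b else X ^ 2 + C φ.b * X + C φ.c

theorem eval_poly (φ : ShiftFactor) (k : ℤ) : φ.poly.eval k = φ.val k := by
  unfold poly val
  split_ifs <;> simp

theorem poly_monic (φ : ShiftFactor) : φ.poly.Monic := by
  unfold poly
  split_ifs
  · exact monic_X_add_C _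
  · monicity!

theorem natDegree_poly (φ : ShiftFactor) : φ.poly.natDegree = φ.deg := by
  unfold poly deg
  split_ifs
  · exact natDegree_X_add_C _
  · compute_degree!

theorem eval_prod_poly (L : Multiset ShiftFactor) (k : ℤ) :
    (L.map poly).prod.eval k = (L.map fun φ => φ.val k).prod := by
  rw [eval_multiset_prod, Multiset.map_map]
  simp [eval_poly]

theorem natDegree_prod_poly (L : Multiset ShiftFactor) :
    (L.map poly).prod.natDegree = (L.map deg).sum := by
  rw [natDegree_multiset_prod_of_monic _ (by
    intro q hq
    obtain ⟨φ, -, rfl⟩ := Multiset.mem_map.1 hq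
    exact φ.poly_monic), Multiset.map_map]
  simp [natDegree_poly]

theorem prod_Icc_eval (L : Multiset ShiftFactor) (n : ℕ) :
    ∏ k ∈ Finset.Icc 1 n, (L.map poly).prod.eval (k : ℤ) = (L.map (prodVal · n)).prod := by
  simp only [eval_prod_poly]
  induction L using Multiset.induction_on with
  | empty => simp
  | cons φ L ih =>
    simp only [Multiset.map_cons, Multiset.prod_cons, Finset.prod_mul_distrib, ih]
    rfl

theorem card_le_natDegree (L : Multiset ShiftFactor) : L.card ≤ (L.map poly).prod.natDegree := by
  rw [natDegree_prod_poly]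
  have h := Multiset.card_nsmul_le_sum (s := L.map deg) (a := 1) (by
    intro x hx
    obtain ⟨φ, -, rfl⟩ := Multiset.mem_map.1 hx
    unfold deg
    split_ifs <;> omega)
  simpa using h

end ShiftFactor

/-- A monic integer polynomial that splits over a quadratic field is a product of linear factors
and of quadratic factors with discriminants in one square class. -/
theorem exists_shiftFactors {K : Type*} [Field K] [Algebra ℚ K] (hK : Module.finrank ℚ K = 2)
    {D : ℤ} (hD : ∀ d : ℤ, ¬ IsSquare d → (∃ x : K, x ^ 2 = d) →
      ∃ m : ℕ, m ≠ 0 ∧ d = (m : ℤ) ^ 2 * D) {f : ℤ[X]} (hf : f.Monic)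
    (hs : (f.map (algebraMap ℤ K)).Splits) :
    ∃ F : Multiset ShiftFactor, (F.map ShiftFactor.poly).prod = f ∧ ∀ φ ∈ F, φ.HasDisc D := by
  have : CharZero K := algebraRat.charZero K
  have : FiniteDimensional ℚ K := Module.finite_of_finrank_pos (by omega)
  induction hd : f.natDegree using Nat.strong_induction_on generalizing f with
  | _ d ih =>
    subst hd
    rcases Nat.eq_zero_or_pos f.natDegree with h0 | hpos
    · exact ⟨0, by simp [hf.natDegree_eq_zero.1 h0], by simp⟩
    obtain ⟨α, hα⟩ := hs.exists_eval_eq_zero (by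
      rw [hf.degree_map]
      exact (natDegree_pos_iff_degree_pos.1 hpos).ne')
    rw [eval_map_algebraMap] at hα
    have hint : IsIntegral ℤ α := ⟨f, hf, by rwa [← aeval_def]⟩
    obtain ⟨f', hff'⟩ := minpoly.isIntegrallyClosed_dvd hint hα
    set q := minpoly ℤ α with hq
    have hqm : q.Monic := minpoly.monic hint
    have hqQ : minpoly ℚ α = q.map (algebraMap ℤ ℚ) :=
      minpoly.isIntegrallyClosed_eq_field_fractions' ℚ hint
    have hqpos : 0 < q.natDegree := minpoly.natDegree_pos hint
    have hq2 : q.natDegree ≤ 2 := by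
      have h := minpoly.natDegree_le (A := ℚ) α
      rwa [hqQ, hqm.natDegree_map, hK] at h
    have hf'm : f'.Monic := hqm.of_mul_monic_left (hff' ▸ hf)
    have hdeg : f.natDegree = q.natDegree + f'.natDegree := by
      rw [hff', hqm.natDegree_mul hf'm]
    obtain ⟨F, hF, hFD⟩ := ih f'.natDegree (by omega) hf'm (by
      refine hs.of_dvd (hf.map _).ne_zero (Polynomial.map_dvd _ ?_)
      exact ⟨q, by rw [hff', mul_comm]⟩) rfl
    suffices h : ∃ φ : ShiftFactor, φ.poly = q ∧ φ.HasDisc D by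
      obtain ⟨φ, hφ, hφD⟩ := h
      refine ⟨φ ::ₘ F, by rw [Multiset.map_cons, Multiset.prod_cons, hφ, hF, hff'], ?_⟩
      intro ψ hψ
      rcases Multiset.mem_cons.1 hψ with rfl | hψ
      · exact hφD
      · exact hFD ψ hψ
    rcases (by omega : q.natDegree = 1 ∨ q.natDegree = 2) with h1 | h2
    · refine ⟨⟨0, q.coeff 0, 0⟩, ?_, fun h => absurd rfl h⟩
      rw [hqm.eq_X_add_C h1]
      simp [ShiftFactor.poly]
    · set b := q.coeff 1 with hb
      set c := q.coeff 0 with hc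
      have hqe : q = X ^ 2 + C b * X + C c := by
        have h3 := q.as_sum_range_C_mul_X_pow
        have h4 : q.coeff 2 = 1 := by rw [← h2]; exact hqm.coeff_natDegree
        rw [h2, Finset.sum_range_succ, Finset.sum_range_succ, Finset.sum_range_one, h4] at h3
        rw [h3, hb, hc]
        simp only [pow_zero, mul_one, pow_one, map_one, one_mul]
        ring
      have hroot : α ^ 2 + b * α + c = 0 := by
        have h3 := minpoly.aeval ℤ α
        rw [← hq, hqe] at h3
        simpa using h3
      have hsq : (2 * α + b) ^ 2 = ((b ^ 2 - 4 * c : ℤ) : K) := by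
        push_cast
        linear_combination 4 * hroot
      have hnsq : ¬ IsSquare (b ^ 2 - 4 * c) := by
        rintro ⟨e, he⟩
        rw [he] at hsq
        have h3 : (2 * α + b - e) * (2 * α + b + e) = 0 := by
          push_cast at hsq
          linear_combination hsq
        have h4 : ∃ z : ℚ, α = algebraMap ℚ K z := by
          have htwo : (2 : K) ≠ 0 := two_ne_zero
          rcases mul_eq_zero.1 h3 with h | h
          · refine ⟨(e - b) / 2, ?_⟩
            rw [map_div₀, map_sub, map_intCast, map_intCast, map_ofNat, eq_div_iff htwo]
            linear_combination h
          · refine ⟨(-e - b) / 2, ?_⟩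
            rw [map_div₀, map_sub, map_neg, map_intCast, map_intCast, map_ofNat, eq_div_iff htwo]
            linear_combination h
        obtain ⟨z, rfl⟩ := h4
        have h5 := congrArg natDegree hqQ
        rw [minpoly.eq_X_sub_C, natDegree_X_sub_C, hqm.natDegree_map, h2] at h5
        omega
      obtain ⟨m, hm, hmD⟩ := hD _ hnsq ⟨_, hsq⟩
      refine ⟨⟨m, b, c⟩, ?_, fun _ => hmD⟩
      rw [hqe]
      simp [ShiftFactor.poly, hm]

/-! ### Bounds for the factors -/

theorem norm_le_of_aeval_eq_zero {f : ℤ[X]} (hf : f.Monic) {S : ℕ} (hS : ∀ i, |f.coeff i| ≤ S)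
    {z : ℂ} (hz : aeval z f = 0) : ‖z‖ ≤ S + 1 := by
  have hfm := hf.map (algebraMap ℤ ℂ)
  have h1 : (f.map (algebraMap ℤ ℂ)).IsRoot z := by rwa [IsRoot.def, eval_map_algebraMap]
  have h2 := IsRoot.norm_lt_cauchyBound hfm.ne_zero h1
  have h3 : cauchyBound (f.map (algebraMap ℤ ℂ)) ≤ (S : NNReal) + 1 := by
    rw [cauchyBound, hfm.leadingCoeff, nnnorm_one, div_one]
    gcongr
    refine Finset.sup_le fun i _ => ?_
    rw [← NNReal.coe_le_coe, coe_nnnorm, coeff_map, eq_intCast, Complex.norm_intCast]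
    have h4 : ((|f.coeff i| : ℤ) : ℝ) ≤ S := by exact_mod_cast hS i
    rw [Int.cast_abs] at h4
    simpa using h4
  have h4 := (h2.le.trans h3)
  rw [← NNReal.coe_le_coe] at h4
  simpa using h4

theorem boundedBy_of_poly_dvd {f : ℤ[X]} (hf : f.Monic) {S : ℕ} (hS : ∀ i, |f.coeff i| ≤ S)
    {D : ℤ} (hD : D ≠ 0) {φ : ShiftFactor} (hφ : φ.HasDisc D) (hdvd : φ.poly ∣ f) :
    φ.BoundedBy (4 * (S + 1) ^ 2) ∧ (φ.m ≠ 0 → |D| ≤ (4 * (S + 1) ^ 2 : ℕ)) := by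
  have hroot : ∀ z : ℂ, aeval z φ.poly = 0 → ‖z‖ ≤ S + 1 := fun z hz =>
    norm_le_of_aeval_eq_zero hf hS (aeval_eq_zero_of_dvd_aeval_eq_zero hdvd hz)
  have hS0 : (0 : ℝ) ≤ S := Nat.cast_nonneg S
  have hle : (S : ℝ) + 1 ≤ 4 * (S + 1) ^ 2 := by nlinarith
  by_cases hm : φ.m = 0
  · have h1 := hroot (-φ.b) (by simp [ShiftFactor.poly, hm])
    rw [norm_neg, Complex.norm_intCast] at h1
    refine ⟨⟨by omega, ?_, fun h => absurd hm h⟩, fun h => absurd hm h⟩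
    have h2 : |(φ.b : ℝ)| ≤ 4 * (S + 1) ^ 2 := h1.trans hle
    exact_mod_cast h2
  · -- the two complex roots of the quadratic
    obtain ⟨w, hw⟩ := IsAlgClosed.exists_pow_nat_eq ((φ.b ^ 2 - 4 * φ.c : ℤ) : ℂ) two_pos
    push_cast at hw
    have hroots : ∀ w' : ℂ, w' ^ 2 = φ.b ^ 2 - 4 * φ.c → ‖(-φ.b + w') / 2‖ ≤ S + 1 := by
      intro w' hw'
      apply hroot
      have h1 : ∀ z : ℂ, aeval z φ.poly = z ^ 2 + φ.b * z + φ.c := fun z => by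
        simp [ShiftFactor.poly, hm]
      rw [h1]
      linear_combination hw' / 4
    have h1 := hroots w hw
    have h2 := hroots (-w) (by rw [neg_sq, hw])
    have hb : |(φ.b : ℝ)| ≤ 2 * (S + 1) := by
      have h3 : ((φ.b : ℤ) : ℂ) = -((-φ.b + w) / 2 + (-φ.b + -w) / 2) := by ring
      rw [← Complex.norm_intCast, h3, norm_neg]
      exact (norm_add_le _ _).trans (by linarith)
    have hc : |(φ.c : ℝ)| ≤ (S + 1) ^ 2 := by
      have h3 : ((φ.c : ℤ) : ℂ) = (-φ.b + w) / 2 * ((-φ.b + -w) / 2) := by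
        linear_combination hw / 4
      rw [← Complex.norm_intCast, h3, norm_mul, sq]
      exact mul_le_mul h1 h2 (norm_nonneg _) (by linarith)
    have hd : |(φ.m : ℝ) ^ 2 * D| ≤ 4 * (S + 1) ^ 2 := by
      have h3 : (((φ.m : ℤ) ^ 2 * D : ℤ) : ℂ) = w ^ 2 := by
        rw [← hφ hm, hw]
        push_cast
        ring
      have h4 : w = (-φ.b + w) / 2 - (-φ.b + -w) / 2 := by ring
      have h5 : ‖w‖ ≤ 2 * (S + 1) := by
        rw [h4]
        exact (norm_sub_le _ _).trans (by linarith)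
      have h6 : |(((φ.m : ℤ) ^ 2 * D : ℤ) : ℝ)| = ‖w‖ ^ 2 := by
        rw [← Complex.norm_intCast, h3, norm_pow]
      push_cast at h6
      rw [h6]
      nlinarith [norm_nonneg w]
    have hd' : |(φ.m : ℤ) ^ 2 * D| ≤ 4 * ((S : ℤ) + 1) ^ 2 := by exact_mod_cast hd
    rw [abs_mul, abs_pow, Nat.abs_cast] at hd'
    have hm1 : (1 : ℤ) ≤ φ.m := by exact_mod_cast Nat.one_le_iff_ne_zero.2 hm
    have hD1 : 1 ≤ |D| := Int.one_le_abs hD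
    have hmm : (φ.m : ℤ) ≤ (φ.m : ℤ) ^ 2 := by nlinarith
    refine ⟨⟨?_, ?_, fun _ => ?_⟩, fun _ => ?_⟩
    · have h3 : (φ.m : ℤ) ≤ 4 * ((S : ℤ) + 1) ^ 2 := by nlinarith
      exact_mod_cast h3
    · have h3 : |(φ.b : ℝ)| ≤ 4 * (S + 1) ^ 2 := by nlinarith
      exact_mod_cast h3
    · have h3 : |(φ.c : ℝ)| ≤ 4 * (S + 1) ^ 2 := by nlinarith
      exact_mod_cast h3
    · push_cast
      nlinarith

/-! ### Polynomials of different degrees -/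

theorem abs_eval_le {f : ℤ[X]} {S d : ℕ} (hS : ∀ i, |f.coeff i| ≤ S) (hd : f.natDegree ≤ d)
    {k : ℤ} (hk : 1 ≤ k) : |f.eval k| ≤ (d + 1) * S * k ^ d := by
  rw [eval_eq_sum_range' (Nat.lt_succ_of_le hd)]
  refine (Finset.abs_sum_le_sum_abs _ _).trans ?_
  have h1 : ∀ i ∈ Finset.range (d + 1), |f.coeff i * k ^ i| ≤ S * k ^ d := by
    intro i hi
    rw [abs_mul, abs_of_nonneg (by positivity : (0 : ℤ) ≤ k ^ i)]
    exact mul_le_mul (hS i) (pow_le_pow_right₀ hk (Nat.lt_succ_iff.1 (Finset.mem_range.1 hi)))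
      (by positivity) (Nat.cast_nonneg S)
  refine (Finset.sum_le_sum h1).trans (le_of_eq ?_)
  rw [Finset.sum_const, Finset.card_range, nsmul_eq_mul]
  push_cast
  ring

theorem pow_sub_le_abs_eval {f : ℤ[X]} (hf : f.Monic) {S d : ℕ} (hS : ∀ i, |f.coeff i| ≤ S)
    (hd : f.natDegree = d + 1) {k : ℤ} (hk : 1 ≤ k) :
    k ^ d * (k - (d + 1) * S) ≤ |f.eval k| := by
  have h1 : f.eval k = f.eraseLead.eval k + k ^ (d + 1) := by
    conv_lhs => rw [← f.eraseLead_add_C_mul_X_pow]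
    simp [hf.leadingCoeff, hd]
  have h2 : |f.eraseLead.eval k| ≤ (d + 1) * S * k ^ d := by
    refine abs_eval_le (fun i => ?_) ((eraseLead_natDegree_le f).trans (by omega)) hk
    rw [eraseLead_coeff]
    split_ifs
    · simp
    · exact hS i
  have h3 := neg_abs_le (f.eraseLead.eval k)
  have h4 := le_abs_self (f.eval k)
  rw [pow_succ] at h1
  nlinarith

/-- Beyond this index the products of the values of two polynomials of different degree are too far
apart to be proportional with constants at most `c`. -/
def growthBound (S c : ℕ) : ℕ :=
  3 * ((S + 1) * S) + c * ((S + 1) * S * (3 * ((S + 1) * S)) ^ S) ^ (3 * ((S + 1) * S))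

/-- The ratio of corresponding values of the two polynomials is at least `2` from an explicit index
on, so the products drift apart geometrically. -/
theorem le_growthBound {P Q : ℤ[X]} (hP : P.Monic) {S c : ℕ} (hSP : ∀ i, |P.coeff i| ≤ S)
    (hSQ : ∀ i, |Q.coeff i| ≤ S) (hdP : P.natDegree ≤ S) (hlt : Q.natDegree < P.natDegree)
    {a b : ℤ} (hb : |b| ≤ c) {n : ℕ}
    (heq : a * ∏ k ∈ Finset.Icc 1 n, P.eval (k : ℤ) = b * ∏ k ∈ Finset.Icc 1 n, Q.eval (k : ℤ))
    (h0 : b * ∏ k ∈ Finset.Icc 1 n, Q.eval (k : ℤ) ≠ 0) : n ≤ growthBound S c := by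
  obtain ⟨d, hd⟩ : ∃ d, P.natDegree = d + 1 := ⟨P.natDegree - 1, by omega⟩
  have hS1 : 1 ≤ S := by omega
  set T := (S + 1) * S with hT
  have hT1 : 1 ≤ T := Nat.mul_pos (by omega) hS1
  have hTd : ((d : ℤ) + 1) * S ≤ T := by
    have : (d + 1) * S ≤ T := Nat.mul_le_mul_right S (by omega)
    exact_mod_cast this
  by_contra! hn
  have hb0 : growthBound S c = 3 * T + c * (T * (3 * T) ^ S) ^ (3 * T) := rfl
  rw [hb0] at hn
  have hP0 : ∏ k ∈ Finset.Icc 1 n, P.eval (k : ℤ) ≠ 0 := right_ne_zero_of_mul (heq ▸ h0)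
  have hQle : ∀ k : ℤ, 1 ≤ k → |Q.eval k| ≤ T * k ^ d := by
    intro k hk
    refine (abs_eval_le hSQ (by omega : Q.natDegree ≤ d) hk).trans ?_
    exact mul_le_mul_of_nonneg_right hTd (by positivity)
  have key : ∀ i, 3 * T + i ≤ n →
      2 ^ i * ∏ k ∈ Finset.Icc 1 (3 * T + i), |Q.eval (k : ℤ)|
        ≤ ((T * (3 * T) ^ S) ^ (3 * T) : ℕ) * ∏ k ∈ Finset.Icc 1 (3 * T + i), |P.eval (k : ℤ)| := by
    intro i
    induction i with
    | zero =>
      intro hin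
      rw [pow_zero, one_mul, add_zero]
      have h1 : ∏ k ∈ Finset.Icc 1 (3 * T), |Q.eval (k : ℤ)| ≤ ((T * (3 * T) ^ S) ^ (3 * T) : ℕ) := by
        have h2 : ∀ k ∈ Finset.Icc 1 (3 * T), |Q.eval (k : ℤ)| ≤ (T * (3 * T) ^ S : ℕ) := by
          intro k hk
          rw [Finset.mem_Icc] at hk
          have hk1 : (1 : ℤ) ≤ k := by exact_mod_cast hk.1
          refine (hQle k hk1).trans ?_
          have h3 : k ^ d ≤ (3 * T) ^ S :=
            (Nat.pow_le_pow_left hk.2 d).trans (Nat.pow_le_pow_right (by omega) (by omega))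
          exact_mod_cast Nat.mul_le_mul_left T h3
        refine (Finset.prod_le_prod (fun _ _ => abs_nonneg _) h2).trans (le_of_eq ?_)
        rw [Finset.prod_const, Nat.card_Icc]
        push_cast
        simp
      have h2 : 1 ≤ ∏ k ∈ Finset.Icc 1 (3 * T), |P.eval (k : ℤ)| := by
        rw [← Finset.abs_prod]
        refine Int.one_le_abs (Finset.prod_ne_zero_iff.2 fun k hk => ?_)
        rw [Finset.mem_Icc] at hk
        exact Finset.prod_ne_zero_iff.1 hP0 k (Finset.mem_Icc.2 ⟨hk.1, by omega⟩)
      nlinarith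
    | succ i ih =>
      intro hin
      have h1 := ih (by omega)
      rw [← add_assoc, Finset.prod_Icc_succ_top (by omega), Finset.prod_Icc_succ_top (by omega)]
      set k : ℤ := ((3 * T + i + 1 : ℕ) : ℤ) with hk
      have hk3 : (3 * T : ℤ) ≤ k := by rw [hk]; push_cast; linarith
      have hT1' : (1 : ℤ) ≤ T := by exact_mod_cast hT1
      have h2 : 2 * |Q.eval k| ≤ |P.eval k| := by
        have h3 := hQle k (by linarith)
        have h4 := pow_sub_le_abs_eval hP hSP hd (k := k) (by linarith)
        have h5 : (0 : ℤ) ≤ k ^ d := pow_nonneg (by linarith) d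
        nlinarith
      have h6 : (0 : ℤ) ≤ 2 ^ i * ∏ k ∈ Finset.Icc 1 (3 * T + i), |Q.eval (k : ℤ)| :=
        mul_nonneg (by positivity) (Finset.prod_nonneg fun _ _ => abs_nonneg _)
      have h7 := mul_le_mul h1 h2 (mul_nonneg two_pos.le (abs_nonneg _)) (h6.trans h1)
      rw [pow_succ]
      linarith
  obtain ⟨i, rfl⟩ : ∃ i, n = 3 * T + i := ⟨n - 3 * T, by omega⟩
  have h1 := key i le_rfl
  have h2 := congrArg abs heq
  rw [abs_mul, abs_mul, Finset.abs_prod, Finset.abs_prod] at h2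
  rw [Finset.prod_ne_zero_iff] at hP0
  have ha : 1 ≤ |a| := Int.one_le_abs (left_ne_zero_of_mul (heq ▸ h0))
  have hQpos : 0 < ∏ k ∈ Finset.Icc 1 (3 * T + i), |Q.eval (k : ℤ)| := by
    rw [← Finset.abs_prod]
    exact abs_pos.2 (right_ne_zero_of_mul h0)
  set E : ℕ := (T * (3 * T) ^ S) ^ (3 * T) with hE
  set U := ∏ k ∈ Finset.Icc 1 (3 * T + i), |P.eval (k : ℤ)| with hU
  set V := ∏ k ∈ Finset.Icc 1 (3 * T + i), |Q.eval (k : ℤ)| with hV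
  have hU0 : 0 ≤ U := Finset.prod_nonneg fun _ _ => abs_nonneg _
  have h3 : (2 : ℤ) ^ i * V ≤ (c * E : ℕ) * V := by
    calc (2 : ℤ) ^ i * V ≤ E * U := h1
      _ ≤ E * (|a| * U) := mul_le_mul_of_nonneg_left (by nlinarith) (Nat.cast_nonneg E)
      _ = |b| * (E * V) := by rw [h2]; ring
      _ ≤ c * (E * V) := mul_le_mul_of_nonneg_right hb (by positivity)
      _ = (c * E : ℕ) * V := by push_cast; ring
  have h4 : 2 ^ i ≤ c * E := by exact_mod_cast le_of_mul_le_mul_right h3 hQpos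
  have h5 : i < 2 ^ i := Nat.lt_two_pow_self
  omega

/-! ### Computability -/

/-- An integer as a difference of two natural numbers. -/
def natPair (z : ℤ) : ℕ × ℕ := (z.toNat, (-z).toNat)

/-- The integer represented by a pair of natural numbers. -/
def pairVal (a : ℕ × ℕ) : ℤ := a.1 - a.2

/-- Multiplication of differences of natural numbers. -/
def pairMul (a b : ℕ × ℕ) : ℕ × ℕ := (a.1 * b.1 + a.2 * b.2, a.1 * b.2 + a.2 * b.1)

/-- Horner's scheme for a list of coefficients, leading coefficient first. -/
def hornerPair (L : List ℤ) (k : ℕ) : ℕ × ℕ :=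
  L.foldl (fun a z => (a.1 * k + (natPair z).1, a.2 * k + (natPair z).2)) (0, 0)

/-- The product of the values at `1, …, n` of a polynomial given by its coefficients. -/
def prodPair (L : List ℤ) (n : ℕ) : ℕ × ℕ :=
  Nat.rec (1, 0) (fun k a => pairMul a (hornerPair L (k + 1))) n

/-- The sum of the absolute values of a list of integers, increased by its length. -/
def listSize (L : List ℤ) : ℕ :=
  L.foldl (fun s z => s + ((natPair z).1 + (natPair z).2 + 1)) 0

/-- The finite data presenting an instance, see `MembershipInstance.code`. -/
abbrev InstanceCode : Type := List ℤ × List ℤ × (ℤ × ℕ) × (ℤ × ℕ)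

/-- The size of a presentation: it bounds the degrees, all coefficients, and the numerators and
denominators. -/
def codeSize (x : InstanceCode) : ℕ :=
  listSize x.1 + listSize x.2.1 +
    ((natPair x.2.2.1.1).1 + (natPair x.2.2.1.1).2 + x.2.2.1.2) +
    ((natPair x.2.2.2.1).1 + (natPair x.2.2.2.1).2 + x.2.2.2.2)

/-- Whether the target is hit at index `n`, as an identity of integers. -/
def hits (n : ℕ) (x : InstanceCode) : Prop :=
  pairVal (pairMul (pairMul (natPair x.2.2.1.1) (x.2.2.2.2, 0)) (prodPair x.2.1 n)) =
    pairVal (pairMul (pairMul (natPair x.2.2.2.1) (x.2.2.1.2, 0)) (prodPair x.1 n))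

/-- An index up to which a member of the sequence of a given size is found if there is one. -/
def searchBound (S : ℕ) : ℕ :=
  ShiftFactor.matchBound (4 * (S + 1) ^ 2) + growthBound S (4 * (S + 1) ^ 2) + (S + 1)

theorem pairVal_natPair (z : ℤ) : pairVal (natPair z) = z := by
  simp only [pairVal, natPair]
  omega

theorem pairVal_mul (a b : ℕ × ℕ) : pairVal (pairMul a b) = pairVal a * pairVal b := by
  simp only [pairVal, pairMul]
  push_cast
  ring

theorem natPair_add (z : ℤ) : (natPair z).1 + (natPair z).2 = z.natAbs := by
  simp only [natPair]
  omega

theorem pairVal_horner_aux (L : List ℤ) (k : ℕ) (a : ℕ × ℕ) :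
    pairVal (L.foldl (fun a z => (a.1 * k + (natPair z).1, a.2 * k + (natPair z).2)) a)
      = L.foldl (fun (s z : ℤ) => s * k + z) (pairVal a) := by
  induction L generalizing a with
  | nil => rfl
  | cons z L ih =>
    rw [List.foldl_cons, List.foldl_cons, ih]
    congr 1
    have h := pairVal_natPair z
    simp only [pairVal] at h ⊢
    push_cast
    linear_combination h

theorem foldl_horner (c : ℕ → ℤ) (x : ℤ) (n : ℕ) (s : ℤ) :
    ((List.range n).reverse.map c).foldl (fun s z => s * x + z) s
      = s * x ^ n + ∑ i ∈ Finset.range n, c i * x ^ i := by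
  induction n generalizing s with
  | zero => simp
  | succ n ih =>
    rw [List.range_succ, List.reverse_append, List.reverse_singleton, List.singleton_append,
      List.map_cons, List.foldl_cons, ih, Finset.sum_range_succ]
    ring

theorem pairVal_hornerPair (f : ℤ[X]) (k : ℕ) :
    pairVal (hornerPair f.coeffList k) = f.eval (k : ℤ) := by
  rw [hornerPair, pairVal_horner_aux, coeffList, foldl_horner]
  simp only [pairVal, Nat.cast_zero, sub_zero, zero_mul, zero_add]
  rcases eq_or_ne f 0 with rfl | hf
  · simp
  · rw [degree_eq_natDegree hf, eval_eq_sum_range]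
    rfl

theorem pairVal_prodPair (f : ℤ[X]) (n : ℕ) :
    pairVal (prodPair f.coeffList n) = ∏ k ∈ Finset.Icc 1 n, f.eval (k : ℤ) := by
  induction n with
  | zero => simp [prodPair, pairVal]
  | succ n ih =>
    rw [Finset.prod_Icc_succ_top (by omega), ← ih, ← pairVal_hornerPair, ← pairVal_mul]
    rfl

theorem listSize_eq (L : List ℤ) : listSize L = (L.map fun z => z.natAbs + 1).sum := by
  have h : ∀ s, L.foldl (fun s z => s + ((natPair z).1 + (natPair z).2 + 1)) s
      = s + (L.map fun z => z.natAbs + 1).sum := by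
    induction L with
    | nil => simp
    | cons z L ih =>
      intro s
      rw [List.foldl_cons, ih, List.map_cons, List.sum_cons, natPair_add, add_assoc]
  rw [listSize, h, zero_add]

theorem natAbs_coeff_le_listSize (f : ℤ[X]) (i : ℕ) :
    (f.coeff i).natAbs ≤ listSize f.coeffList := by
  rw [listSize_eq]
  by_cases hi : i < f.degree.succ
  · have hmem : f.coeff i ∈ f.coeffList := by
      rw [coeffList, List.mem_map]
      exact ⟨i, by simpa using hi, rfl⟩
    have := List.single_le_sum (l := f.coeffList.map fun z => z.natAbs + 1) (by simp) _
      (List.mem_map.2 ⟨_, hmem, rfl⟩)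
    omega
  · rcases eq_or_ne f 0 with rfl | hf
    · simp
    · rw [degree_eq_natDegree hf] at hi
      have : f.natDegree < i := by
        have : ¬ i < f.natDegree + 1 := hi
        omega
      rw [coeff_eq_zero_of_natDegree_lt this]
      simp

theorem natDegree_le_listSize (f : ℤ[X]) : f.natDegree ≤ listSize f.coeffList := by
  rcases eq_or_ne f 0 with rfl | hf
  · simp
  · have h1 : f.coeffList.length ≤ listSize f.coeffList := by
      rw [listSize_eq]
      have := List.length_le_sum_of_one_le (f.coeffList.map fun z => z.natAbs + 1) (by
        intro a ha
        obtain ⟨z, -, rfl⟩ := List.mem_map.1 ha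
        omega)
      simpa using this
    rw [length_coeffList_eq_withBotSucc_degree, degree_eq_natDegree hf] at h1
    have : f.natDegree + 1 ≤ listSize f.coeffList := h1
    omega

theorem primrec_natPair : Primrec natPair := by
  have h1 : ∀ z : ℤ, natPair z = if Encodable.encode z % 2 = 0 then (Encodable.encode z / 2, 0)
      else (0, Encodable.encode z / 2 + 1) := by
    rintro (n | n)
    · have h : Encodable.encode (Int.ofNat n) = 2 * n := rfl
      rw [h, if_pos (by omega)]
      refine Prod.ext ?_ ?_ <;> simp only [natPair, Int.ofNat_eq_natCast] <;> omega
    · have h : Encodable.encode (Int.negSucc n) = 2 * n + 1 := rfl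
      rw [h, if_neg (by omega)]
      refine Prod.ext ?_ ?_ <;> simp only [natPair, Int.negSucc_eq] <;> omega
  have hd : Primrec fun z : ℤ => Encodable.encode z / 2 :=
    Primrec.nat_div.comp Primrec.encode (Primrec.const 2)
  refine (Primrec.ite (Primrec.eq.comp
    (Primrec.nat_mod.comp Primrec.encode (Primrec.const 2)) (Primrec.const 0))
    (Primrec.pair hd (Primrec.const 0))
    (Primrec.pair (Primrec.const 0) (Primrec.succ.comp hd))).of_eq fun z => (h1 z).symm

theorem primrec_pairMul : Primrec₂ pairMul := by
  have h1 : Primrec fun p : (ℕ × ℕ) × (ℕ × ℕ) => p.1.1 := Primrec.fst.comp Primrec.fst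
  have h2 : Primrec fun p : (ℕ × ℕ) × (ℕ × ℕ) => p.1.2 := Primrec.snd.comp Primrec.fst
  have h3 : Primrec fun p : (ℕ × ℕ) × (ℕ × ℕ) => p.2.1 := Primrec.fst.comp Primrec.snd
  have h4 : Primrec fun p : (ℕ × ℕ) × (ℕ × ℕ) => p.2.2 := Primrec.snd.comp Primrec.snd
  exact Primrec.pair
    (Primrec.nat_add.comp (Primrec.nat_mul.comp h1 h3) (Primrec.nat_mul.comp h2 h4))
    (Primrec.nat_add.comp (Primrec.nat_mul.comp h1 h4) (Primrec.nat_mul.comp h2 h3))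

theorem primrec_hornerPair : Primrec₂ hornerPair := by
  have hz : Primrec fun p : (List ℤ × ℕ) × ((ℕ × ℕ) × ℤ) => natPair p.2.2 :=
    primrec_natPair.comp (Primrec.snd.comp Primrec.snd)
  have ha : Primrec fun p : (List ℤ × ℕ) × ((ℕ × ℕ) × ℤ) => p.2.1 :=
    Primrec.fst.comp Primrec.snd
  have hk : Primrec fun p : (List ℤ × ℕ) × ((ℕ × ℕ) × ℤ) => p.1.2 :=
    Primrec.snd.comp Primrec.fst
  have hstep : Primrec₂ fun (q : List ℤ × ℕ) (p : (ℕ × ℕ) × ℤ) =>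
      (p.1.1 * q.2 + (natPair p.2).1, p.1.2 * q.2 + (natPair p.2).2) :=
    Primrec.pair
      (Primrec.nat_add.comp (Primrec.nat_mul.comp (Primrec.fst.comp ha) hk) (Primrec.fst.comp hz))
      (Primrec.nat_add.comp (Primrec.nat_mul.comp (Primrec.snd.comp ha) hk) (Primrec.snd.comp hz))
  exact Primrec.list_foldl Primrec.fst (Primrec.const (0, 0)) hstep

theorem primrec_prodPair : Primrec₂ prodPair := by
  have hstep : Primrec₂ fun (L : List ℤ) (p : ℕ × (ℕ × ℕ)) =>
      pairMul p.2 (hornerPair L (p.1 + 1)) :=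
    primrec_pairMul.comp (Primrec.snd.comp Primrec.snd)
      (primrec_hornerPair.comp Primrec.fst
        (Primrec.succ.comp (Primrec.fst.comp Primrec.snd)))
  exact Primrec.nat_rec (Primrec.const (1, 0)) hstep

theorem primrec_natAbs_sum : Primrec fun z : ℤ => (natPair z).1 + (natPair z).2 :=
  Primrec.nat_add.comp (Primrec.fst.comp primrec_natPair) (Primrec.snd.comp primrec_natPair)

theorem primrec_listSize : Primrec listSize := by
  have hstep : Primrec₂ fun (_ : List ℤ) (p : ℕ × ℤ) =>
      p.1 + ((natPair p.2).1 + (natPair p.2).2 + 1) :=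
    Primrec.nat_add.comp (Primrec.fst.comp Primrec.snd)
      (Primrec.succ.comp (primrec_natAbs_sum.comp (Primrec.snd.comp Primrec.snd)))
  exact Primrec.list_foldl Primrec.id (Primrec.const 0) hstep

theorem primrec_codeSize : Primrec codeSize := by
  have h2 : Primrec fun x : InstanceCode => x.2 := Primrec.snd
  have h3 : Primrec fun x : InstanceCode => x.2.2 := Primrec.snd.comp h2
  have h4 : Primrec fun x : InstanceCode => x.2.2.1 := Primrec.fst.comp h3
  have h5 : Primrec fun x : InstanceCode => x.2.2.2 := Primrec.snd.comp h3
  refine Primrec.nat_add.comp (Primrec.nat_add.comp (Primrec.nat_add.comp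
    (primrec_listSize.comp Primrec.fst) (primrec_listSize.comp (Primrec.fst.comp h2))) ?_) ?_
  · exact Primrec.nat_add.comp (primrec_natAbs_sum.comp (Primrec.fst.comp h4))
      (Primrec.snd.comp h4)
  · exact Primrec.nat_add.comp (primrec_natAbs_sum.comp (Primrec.fst.comp h5))
      (Primrec.snd.comp h5)

theorem primrecRel_hits : PrimrecRel hits := by
  have hx : Primrec fun p : ℕ × InstanceCode => p.2 := Primrec.snd
  have h2 : Primrec fun p : ℕ × InstanceCode => p.2.2 := Primrec.snd.comp hx
  have h3 : Primrec fun p : ℕ × InstanceCode => p.2.2.2 := Primrec.snd.comp h2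
  have h4 : Primrec fun p : ℕ × InstanceCode => p.2.2.2.1 := Primrec.fst.comp h3
  have h5 : Primrec fun p : ℕ × InstanceCode => p.2.2.2.2 := Primrec.snd.comp h3
  have hden : ∀ {g : ℕ × InstanceCode → ℕ}, Primrec g → Primrec fun p => (g p, 0) :=
    fun hg => Primrec.pair hg (Primrec.const 0)
  have hl : Primrec fun p : ℕ × InstanceCode =>
      pairMul (pairMul (natPair p.2.2.2.1.1) (p.2.2.2.2.2, 0)) (prodPair p.2.2.1 p.1) :=
    primrec_pairMul.comp (primrec_pairMul.comp (primrec_natPair.comp (Primrec.fst.comp h4))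
      (hden (Primrec.snd.comp h5))) (primrec_prodPair.comp (Primrec.fst.comp h2) Primrec.fst)
  have hr : Primrec fun p : ℕ × InstanceCode =>
      pairMul (pairMul (natPair p.2.2.2.2.1) (p.2.2.2.1.2, 0)) (prodPair p.2.1 p.1) :=
    primrec_pairMul.comp (primrec_pairMul.comp (primrec_natPair.comp (Primrec.fst.comp h5))
      (hden (Primrec.snd.comp h4))) (primrec_prodPair.comp (Primrec.fst.comp hx) Primrec.fst)
  have hcross := Primrec.eq.comp
    (Primrec.nat_add.comp (Primrec.fst.comp hl) (Primrec.snd.comp hr))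
    (Primrec.nat_add.comp (Primrec.fst.comp hr) (Primrec.snd.comp hl))
  refine hcross.of_eq fun p => ?_
  simp only [hits, pairVal]
  omega

theorem primrec_pow {α : Type*} [Primcodable α] {a b : α → ℕ} (ha : Primrec a) (hb : Primrec b) :
    Primrec fun x => a x ^ b x :=
  (Primrec₂.unpaired'.1 Nat.Primrec.pow).comp ha hb

theorem primrec_searchBound : Primrec searchBound := by
  have hadd : ∀ {a b : ℕ → ℕ}, Primrec a → Primrec b → Primrec fun x => a x + b x :=
    fun ha hb => Primrec.nat_add.comp ha hb
  have hmul : ∀ {a b : ℕ → ℕ}, Primrec a → Primrec b → Primrec fun x => a x * b x :=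
    fun ha hb => Primrec.nat_mul.comp ha hb
  have hpow : ∀ {a b : ℕ → ℕ}, Primrec a → Primrec b → Primrec fun x => a x ^ b x :=
    fun ha hb => primrec_pow ha hb
  have hc : ∀ n : ℕ, Primrec fun _ : ℕ => n := fun n => Primrec.const n
  have hi : Primrec fun x : ℕ => x := Primrec.id
  have hS1 : Primrec fun S : ℕ => S + 1 := hadd hi (hc 1)
  have hsep : Primrec separationBound :=
    hmul hS1 (hmul hi (hadd (hpow (hpow (hc 2) (hmul (hc 120) (hmul (hc 20) (hpow hi (hc 3)))))
      (hc 2)) (hmul (hc 2) hi)))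
  have hshift : Primrec ShiftFactor.shiftBound :=
    hpow (hmul (hc 14) (hpow hS1 (hc 2))) (hmul (hc 2) hi)
  have hmatch : Primrec ShiftFactor.matchBound :=
    hadd (hadd hsep (hmul (hc 2) hi)) (hmul (hmul (hc 2) hi) (hpow hshift hi))
  have hM : Primrec fun S : ℕ => 4 * (S + 1) ^ 2 := hmul (hc 4) (hpow hS1 (hc 2))
  have hT : Primrec fun S : ℕ => 3 * ((S + 1) * S) := hmul (hc 3) (hmul hS1 hi)
  have hgrowth : Primrec fun S : ℕ => growthBound S (4 * (S + 1) ^ 2) :=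
    hadd hT (hmul hM (hpow (hmul (hmul hS1 hi) (hpow hT hi)) hT))
  exact hadd (hadd (hmatch.comp hM) hgrowth) hS1

theorem primrecPred_exists_hits :
    PrimrecPred fun x : InstanceCode => ∃ n ∈ List.range (searchBound (codeSize x) + 1), hits n x :=
  primrecRel_hits.exists_mem_list.comp
    (Primrec.list_range.comp
      (Primrec.succ.comp (primrec_searchBound.comp primrec_codeSize))) Primrec.id

/-! ### Members of bounded index -/

namespace MembershipInstance

variable (I : MembershipInstance)

theorem seq_mul_prod (n : ℕ) :
    I.seq n * ((∏ k ∈ Finset.Icc 1 n, I.f.eval (k : ℤ) : ℤ) : ℚ)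
      = I.init * ((∏ k ∈ Finset.Icc 1 n, I.g.eval (k : ℤ) : ℤ) : ℚ) := by
  induction n with
  | zero => simp [seq]
  | succ n ih =>
    have hf : ((I.f.eval ((n : ℤ) + 1) : ℤ) : ℚ) ≠ 0 := by
      have := I.eval_f_ne_zero (n + 1)
      push_cast at this
      exact_mod_cast this
    rw [Finset.prod_Icc_succ_top (by omega), Finset.prod_Icc_succ_top (by omega), seq]
    push_cast at ih ⊢
    field_simp
    linear_combination ((I.g.eval ((n : ℤ) + 1) : ℤ) : ℚ) * ih

theorem prod_f_ne_zero (n : ℕ) : ∏ k ∈ Finset.Icc 1 n, I.f.eval (k : ℤ) ≠ 0 :=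
  Finset.prod_ne_zero_iff.2 fun k _ => I.eval_f_ne_zero k

theorem seq_eq_target_iff (n : ℕ) :
    I.seq n = I.target ↔
      I.init.num * I.target.den * ∏ k ∈ Finset.Icc 1 n, I.g.eval (k : ℤ)
        = I.target.num * I.init.den * ∏ k ∈ Finset.Icc 1 n, I.f.eval (k : ℤ) := by
  have h := I.seq_mul_prod n
  have hf : ((∏ k ∈ Finset.Icc 1 n, I.f.eval (k : ℤ) : ℤ) : ℚ) ≠ 0 := by
    exact_mod_cast I.prod_f_ne_zero n
  set a := ∏ k ∈ Finset.Icc 1 n, I.f.eval (k : ℤ)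
  set b := ∏ k ∈ Finset.Icc 1 n, I.g.eval (k : ℤ)
  have hi : (I.init.den : ℚ) ≠ 0 := by exact_mod_cast I.init.den_nz
  have ht : (I.target.den : ℚ) ≠ 0 := by exact_mod_cast I.target.den_nz
  have hin : (I.init.num : ℚ) = I.init * I.init.den := (Rat.mul_den_eq_num _).symm
  have htn : (I.target.num : ℚ) = I.target * I.target.den := (Rat.mul_den_eq_num _).symm
  rw [eq_div_of_mul_eq hf h, div_eq_iff hf, ← Int.cast_inj (α := ℚ)]
  push_cast [hin, htn]
  constructor
  · intro h2
    linear_combination (I.init.den * I.target.den : ℚ) * h2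
  · intro h2
    refine mul_left_cancel₀ (mul_ne_zero hi ht) ?_
    linear_combination h2

theorem hits_code_iff (n : ℕ) : hits n I.code ↔ I.seq n = I.target := by
  rw [seq_eq_target_iff]
  simp only [hits, code, pairVal_mul, pairVal_natPair, pairVal_prodPair]
  simp [pairVal]

end MembershipInstance

namespace MembershipInstance

variable (I : MembershipInstance)

theorem exists_index_le_searchBound (hf : I.f.Monic) (hg : I.g.Monic)
    (hs : SplitOverQuadraticField I.f I.g) (hI : I.IsMember) :
    ∃ n ≤ searchBound (codeSize I.code), I.seq n = I.target := by
  obtain ⟨n, hn⟩ := hI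
  set S := codeSize I.code with hS
  have hsize : listSize I.f.coeffList + listSize I.g.coeffList +
      (I.init.num.natAbs + I.init.den) + (I.target.num.natAbs + I.target.den) = S := by
    rw [hS, codeSize, natPair_add, natPair_add]
    rfl
  have hcf : ∀ i, |I.f.coeff i| ≤ S := fun i => by
    have := natAbs_coeff_le_listSize I.f i
    rw [Int.abs_eq_natAbs]
    omega
  have hcg : ∀ i, |I.g.coeff i| ≤ S := fun i => by
    have := natAbs_coeff_le_listSize I.g i
    rw [Int.abs_eq_natAbs]
    omega
  have hdf : I.f.natDegree ≤ S := (natDegree_le_listSize I.f).trans (by omega)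
  have hdg : I.g.natDegree ≤ S := (natDegree_le_listSize I.g).trans (by omega)
  rcases Nat.lt_or_ge (searchBound S) n with hlt | hle
  swap
  · exact ⟨n, hle, hn⟩
  have hbound : searchBound S = ShiftFactor.matchBound (4 * (S + 1) ^ 2)
    + growthBound S (4 * (S + 1) ^ 2) + (S + 1) := rfl
  have heq := (I.seq_eq_target_iff n).1 hn
  have hF0 := I.prod_f_ne_zero n
  by_cases hi0 : I.init = 0
  · refine ⟨0, Nat.zero_le _, ?_⟩
    have h1 := I.seq_mul_prod n
    rw [hi0, zero_mul, hn] at h1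
    rcases mul_eq_zero.1 h1 with h2 | h2
    · rw [h2]
      exact hi0
    · exact absurd (by exact_mod_cast h2) hF0
  have hin : I.init.num ≠ 0 := Rat.num_ne_zero.2 hi0
  have hid : (I.init.den : ℤ) ≠ 0 := by exact_mod_cast I.init.den_nz
  have htd : (I.target.den : ℤ) ≠ 0 := by exact_mod_cast I.target.den_nz
  by_cases ht0 : I.target = 0
  · -- the sequence vanishes from the first positive integer root of `g` on
    rw [ht0, Rat.num_zero, zero_mul, zero_mul] at heq
    have h1 : ∏ k ∈ Finset.Icc 1 n, I.g.eval (k : ℤ) = 0 := by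
      rcases mul_eq_zero.1 heq with h | h
      · rw [Rat.den_zero, Nat.cast_one, mul_one] at h
        exact absurd h hin
      · exact h
    obtain ⟨k, hk, hgk⟩ := Finset.prod_eq_zero_iff.1 h1
    rw [Finset.mem_Icc] at hk
    refine ⟨k, ?_, ?_⟩
    · have h2 : aeval (k : ℂ) I.g = 0 := by
        have h3 : aeval (algebraMap ℤ ℂ (k : ℤ)) I.g = algebraMap ℤ ℂ (I.g.eval (k : ℤ)) :=
          aeval_algebraMap_apply_eq_algebraMap_eval _ _
        rw [hgk, map_zero] at h3
        simpa using h3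
      have h4 := norm_le_of_aeval_eq_zero hg hcg h2
      rw [Complex.norm_natCast] at h4
      have h5 : k ≤ S + 1 := by exact_mod_cast h4
      omega
    · rw [seq_eq_target_iff, ht0,
        Finset.prod_eq_zero (Finset.mem_Icc.2 ⟨hk.1, le_rfl⟩) hgk]
      simp
  have htn : I.target.num ≠ 0 := Rat.num_ne_zero.2 ht0
  have hprod : ∀ a : ℤ, ∀ b : ℕ, a.natAbs + b ≤ S → |a * b| ≤ (4 * (S + 1) ^ 2 : ℕ) := by
    intro a b hab
    have h1 : a.natAbs * b ≤ S * S := Nat.mul_le_mul (by omega) (by omega)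
    have h2 : S * S ≤ 4 * (S + 1) ^ 2 := by nlinarith
    rw [Int.abs_eq_natAbs, Int.natAbs_mul, Int.natAbs_natCast]
    exact_mod_cast h1.trans h2
  have hc := hprod I.init.num I.target.den (by omega)
  have hc' := hprod I.target.num I.init.den (by omega)
  have h0 : I.target.num * I.init.den * ∏ k ∈ Finset.Icc 1 n, I.f.eval (k : ℤ) ≠ 0 :=
    mul_ne_zero (mul_ne_zero htn hid) hF0
  rcases Nat.lt_trichotomy I.f.natDegree I.g.natDegree with hlt' | hdeg | hlt'
  · have := le_growthBound hg hcg hcf hdg hlt' hc' heq h0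
    omega
  · obtain ⟨K, hK, hsf, hsg⟩ := hs
    obtain ⟨D, hD, hDK⟩ := exists_squareClass hK
    have hD0 : D ≠ 0 := by
      rintro rfl
      exact hD IsSquare.zero
    obtain ⟨F, hF, hFD⟩ := exists_shiftFactors hK hDK hf hsf
    obtain ⟨G, hG, hGD⟩ := exists_shiftFactors hK hDK hg hsg
    have hFb := fun φ (hφ : φ ∈ F) => boundedBy_of_poly_dvd hf hcf hD0 (hFD φ hφ)
      (hF ▸ Multiset.dvd_prod (Multiset.mem_map_of_mem _ hφ))
    have hGb := fun φ (hφ : φ ∈ G) => boundedBy_of_poly_dvd hg hcg hD0 (hGD φ hφ)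
      (hG ▸ Multiset.dvd_prod (Multiset.mem_map_of_mem _ hφ))
    have hSM : S ≤ 4 * (S + 1) ^ 2 := by nlinarith
    have hcard : F.card ≤ 4 * (S + 1) ^ 2 :=
      ((ShiftFactor.card_le_natDegree F).trans (by rw [hF]; exact hdf)).trans hSM
    rw [← hF, ← hG, ShiftFactor.prod_Icc_eval, ShiftFactor.prod_Icc_eval] at heq
    rw [← hF, ShiftFactor.prod_Icc_eval] at h0
    rw [← hF, ← hG, ShiftFactor.natDegree_prod_poly, ShiftFactor.natDegree_prod_poly] at hdeg
    have hcc := ShiftFactor.const_eq_of_prod_eq (D := D) (by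
        rintro ⟨φ, hφ, hm⟩
        refine ⟨hD, ?_⟩
        rcases Multiset.mem_add.1 hφ with h | h
        · exact (hFb φ h).2 hm
        · exact (hGb φ h).2 hm)
      (fun φ hφ => ⟨hFD φ hφ, (hFb φ hφ).1⟩) (fun φ hφ => ⟨hGD φ hφ, (hGb φ hφ).1⟩)
      hcard hdeg (by omega) hc hc' heq h0
    refine ⟨0, Nat.zero_le _, ?_⟩
    rw [seq_eq_target_iff, hcc]
    simp
  · rw [← heq] at h0
    have := le_growthBound hf hcf hcg hdf hlt' hc heq.symm h0
    omega

end MembershipInstance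

theorem mainTheorem2 :
    MembershipDecidableOn
      {I : MembershipInstance | I.f.Monic ∧ I.g.Monic ∧ SplitOverQuadraticField I.f I.g} := by
  obtain ⟨hdec, hA⟩ := primrecPred_exists_hits
  refine ⟨fun x => decide (∃ n ∈ List.range (searchBound (codeSize x) + 1), hits n x),
    hA.to_comp, fun I ⟨hf, hg, hs⟩ => decide_eq_true_iff.trans ⟨?_, fun h => ?_⟩⟩
  · rintro ⟨n, -, hn⟩
    exact ⟨n, (I.hits_code_iff n).1 hn⟩
  · obtain ⟨n, hle, hn⟩ := I.exists_index_le_searchBound hf hg hs h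
    exact ⟨n, List.mem_range.2 (Nat.lt_succ_of_le hle), (I.hits_code_iff n).2 hn⟩
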